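/- Let $q\in\mathbb{C}^\times$ be not a root of unity; put $q_1=q$, $q_2=q^{-1}$, $[s]=\frac{q^s-q^{-s}}{q-q^{-1}}$. Give the indices $1,2$ the parities $|1|=\bar 0$, $|2|=\bar 1$, let $V=\mathbb{C}v_1\oplus\mathbb{C}v_2$ with $|v_i|=|i|$, and let $E_{ij}\in\operatorname{End}V$ be the matrix units. All tensor products are tensor products of superalgebras, $(x\otimes y)(x'\otimes y')=(-1)^{|y||x'|}xx'\otimes yy'$. Let $$R(z,w)=\sum_{i}(zq_i-wq_i^{-1})E_{ii}\otimes E_{ii}+(z-w)\sum_{i\ne j}E_{ii}\otimes E_{jj}+z(q-q^{-1})E_{21}\otimes E_{12}+w(q^{-1}-q)E_{12}\otimes E_{21}.$$ Let $U=U_q(\widehat{\mathfrak{gl}(1,1)})$ be the superalgebra over $\mathbb{C}$ generated by $s_{ij}^{(n)},t_{ij}^{(n)}$ ($i,j\in\{1,2\}$, $n\ge 0$), of parity $|i|+|j|$, with relations $$R_{23}(z,w)T_{12}(z)T_{13}(w)=T_{13}(w)T_{12}(z)R_{23}(z,w),\quad R_{23}(z,w)S_{12}(z)S_{13}(w)=S_{13}(w)S_{12}(z)R_{23}(z,w),$$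 $$R_{23}(z,w)T_{12}(z)S_{13}(w)=S_{13}(w)T_{12}(z)R_{23}(z,w),\quad t_{12}^{(0)}=s_{21}^{(0)}=0,\quad t_{ii}^{(0)}s_{ii}^{(0)}=1=s_{ii}^{(0)}t_{ii}^{(0)},$$ where $S(z)=\sum_{i,j} s_{ij}(z)\otimes E_{ij}$, $s_{ij}(z)=\sum_{n\ge0}s_{ij}^{(n)}z^n$, $T(z)=\sum_{i,j} t_{ij}(z)\otimes E_{ij}$, $t_{ij}(z)=\sum_{n\ge0}t_{ij}^{(n)}z^{-n}$. Let $\Delta:U\to U\otimes U$ be the morphism of superalgebras such that, with $\epsilon(i,j,k)=(-1)^{(|i|+|k|)(|k|+|j|)}$, $$\Delta(s_{ij}(z))=\sum_{k}\epsilon(i,j,k)\,s_{ik}(z)\otimes s_{kj}(z),\qquad \Delta(t_{ij}(z))=\sum_{k}\epsilon(i,j,k)\,t_{ik}(z)\otimes t_{kj}(z).$$ Define series $E^\pm(z),F^\pm(z),K_1^\pm(z),K_2^\pm(z)$ by the Gauss decompositions (upper sign for $S$, in powers of $z$; lower sign for $T$, in powers of $z^{-1}$) $$S(z)=\begin{pmatrix}1&0\\F^+&1\end{pmatrix}\begin{pmatrix}K_1^+&0\\0&K_2^+\end{pmatrix}\begin{pmatrix}1&E^+\\0&1\end{pmatrix},\qquad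 T(z)=\begin{pmatrix}1&0\\F^-&1\end{pmatrix}\begin{pmatrix}K_1^-&0\\0&K_2^-\end{pmatrix}\begin{pmatrix}1&E^-\\0&1\end{pmatrix},$$ where a matrix $(x_{ij})$ stands for $\sum_{i,j} x_{ij}\otimes E_{ij}$, so that the product of $(x_{ij})$ and $(y_{ij})$ has entries $\sum_k\epsilon(i,j,k)x_{ik}y_{kj}$. Put $\phi^\pm(z)=K_1^\pm(z)^{-1}K_2^\pm(z)$ and define the Drinfeld generators $E_n,F_n$ ($n\in\mathbb{Z}$) and $h_s,C_s$ ($s\in\mathbb{Z}_{\neq0}$) of $U$ by $$E^+(z)=\sum_{n\ge0}E_nz^n,\quad E^-(z)=-\sum_{n\le-1}E_nz^n,\quad F^+(z)=-\sum_{n\ge1}F_nz^n,\quad F^-(z)=\sum_{n\le0}F_nz^n,$$ $$K_1^\pm(z)=(s_{11}^{(0)})^{\pm1}\exp\Big(\pm(q-q^{-1})\sum_{s>0}h_{\pm s}z^{\pm s}\Big),\quad \phi^\pm(z)=\big((s_{11}^{(0)})^{-1}s_{22}^{(0)}\big)^{\pm1}\exp\Big(\pm(q-q^{-1})\sum_{s>0}C_{\pm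 s}z^{\pm s}\Big).$$ Then $$\Delta(E^\pm(z))=1\otimes E^\pm(z)+E^\pm(z)\otimes\phi^\pm(z),\qquad \Delta(F^\pm(z))=\phi^\pm(z)\otimes F^\pm(z)+F^\pm(z)\otimes1,$$ $$\Delta(\phi^\pm(z))=\phi^\pm(z)\otimes\phi^\pm(z),\qquad \Delta(C_s)=1\otimes C_s+C_s\otimes1\quad(s\in\mathbb{Z}_{\neq0}),$$ and for all integers $s>0$ $$\Delta(h_s)=1\otimes h_s+h_s\otimes1+\frac{q^s[s]}{s(q-q^{-1})}\sum_{i=0}^{s-1}E_i\otimes F_{s-i},$$ $$\Delta(h_{-s})=1\otimes h_{-s}+h_{-s}\otimes1+\frac{q^{-s}[s]}{s(q^{-1}-q)}\sum_{i=0}^{s-1}E_{-s+i}\otimes F_{-i}.$$ -/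

import Mathlib

open scoped TensorProduct PowerSeries GradedTensorProduct

namespace QAffGL

noncomputable section

/-- The symbols of the RTT generators `s_ij^(n)`, `t_ij^(n)` (`n ≥ 0`).  The indices `1, 2` are
written `0, 1 : Fin 2`; thus the parity of an index `i : Fin 2` is the parity of the number `i`. -/
inductive Gen : Type
  | s (i j : Fin 2) (n : ℕ)
  | t (i j : Fin 2) (n : ℕ)

/-- The Koszul sign `(-1)^{(|i|+|j|)(|k|+|l|)}`. -/
def sgn (i j k l : Fin 2) : ℂ := (-1) ^ (((i : ℕ) + j) * ((k : ℕ) + l))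

/-- `q_1 = q`, `q_2 = q⁻¹`. -/
def qd (q : ℂ) (i : Fin 2) : ℂ := if i = 0 then q else q⁻¹

/-- Write the Perk-Schultz matrix as `R(z,w) = z R' + w R''`.  `Rz q i j k l` is the coefficient of
`E_ij ⊗ E_kl` in `R'`. -/
def Rz (q : ℂ) (i j k l : Fin 2) : ℂ :=
  if i = j ∧ k = l then (if i = k then qd q i else 1)
  else if i = 1 ∧ j = 0 ∧ k = 0 ∧ l = 1 then q - q⁻¹ else 0

/-- The coefficient of `E_ij ⊗ E_kl` in `R''`, where `R(z,w) = z R' + w R''`. -/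
def Rw (q : ℂ) (i j k l : Fin 2) : ℂ :=
  if i = j ∧ k = l then (if i = k then -(qd q i)⁻¹ else -1)
  else if i = 0 ∧ j = 1 ∧ k = 1 ∧ l = 0 then q⁻¹ - q else 0

/-- For `X(z) = ∑ X_ij(z) ⊗ E_ij` and `Y(w) = ∑ Y_ij(w) ⊗ E_ij`, where `X a b m` is the coefficient
of `z^m` in `X_ab(z)`, this is the coefficient of `z^m w^n` and of `E_ib ⊗ E_kd` in
`R_23(z,w) X_12(z) Y_13(w)`, computed in the tensor product of superalgebras
`A ⊗ End V ⊗ End V`, where `(x ⊗ y)(x' ⊗ y') = (-1)^{|y||x'|} xx' ⊗ yy'`: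
`X_12 Y_13 = ∑ (-1)^{(|a|+|b|)(|c|+|d|)} X_ab Y_cd ⊗ E_ab ⊗ E_cd` and
`(E_ia ⊗ E_kc)(E_ab ⊗ E_cd) = (-1)^{(|k|+|c|)(|a|+|b|)} E_ib ⊗ E_kd`,
so that the total sign is `(-1)^{(|a|+|b|)(|k|+|d|)}`. -/
def rttL {A : Type*} [Ring A] [Algebra ℂ A] (q : ℂ) (X Y : Fin 2 → Fin 2 → ℤ → A) (m n : ℤ)
    (i b k d : Fin 2) : A :=
  ∑ a, ∑ c, sgn a b k d •
    (Rz q i a k c • (X a b (m - 1) * Y c d n) + Rw q i a k c • (X a b m * Y c d (n - 1)))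

/-- The coefficient of `z^m w^n` and of `E_ib ⊗ E_kd` in `Y_13(w) X_12(z) R_23(z,w)`:
`Y_13 X_12 = ∑ Y_kc X_ia ⊗ E_ia ⊗ E_kc` and
`(E_ia ⊗ E_kc)(E_ab ⊗ E_cd) = (-1)^{(|k|+|c|)(|a|+|b|)} E_ib ⊗ E_kd`. -/
def rttR {A : Type*} [Ring A] [Algebra ℂ A] (q : ℂ) (X Y : Fin 2 → Fin 2 → ℤ → A) (m n : ℤ)
    (i b k d : Fin 2) : A :=
  ∑ a, ∑ c, sgn k c a b •
    (Rz q a b c d • (Y k c n * X i a (m - 1)) + Rw q a b c d • (Y k c (n - 1) * X i a m))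

/-- `upModes x i j k` is the coefficient of `z^k` in `∑_{n ≥ 0} x_ij^(n) z^n`. -/
def upModes {A : Type*} [Zero A] (x : Fin 2 → Fin 2 → ℕ → A) (i j : Fin 2) (k : ℤ) : A :=
  if 0 ≤ k then x i j k.toNat else 0

/-- `downModes x i j k` is the coefficient of `z^k` in `∑_{n ≥ 0} x_ij^(n) z^{-n}`. -/
def downModes {A : Type*} [Zero A] (x : Fin 2 → Fin 2 → ℕ → A) (i j : Fin 2) (k : ℤ) : A :=
  if k ≤ 0 then x i j (-k).toNat else 0

/-- The free generator `s_ij^(n)`. -/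
def gs (i j : Fin 2) (n : ℕ) : FreeAlgebra ℂ Gen := FreeAlgebra.ι ℂ (Gen.s i j n)

/-- The free generator `t_ij^(n)`. -/
def gt (i j : Fin 2) (n : ℕ) : FreeAlgebra ℂ Gen := FreeAlgebra.ι ℂ (Gen.t i j n)

/-- The defining relations: the coefficients of the three RTT relations (for `TT`, `SS`, `TS`),
`t_12^(0) = s_21^(0) = 0`, and `t_ii^(0)`, `s_ii^(0)` are inverse to each other. -/
inductive Rel (q : ℂ) : FreeAlgebra ℂ Gen → FreeAlgebra ℂ Gen → Prop
  | tt (m n : ℤ) (i j k l : Fin 2) :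
      Rel q (rttL q (downModes gt) (downModes gt) m n i j k l)
        (rttR q (downModes gt) (downModes gt) m n i j k l)
  | ss (m n : ℤ) (i j k l : Fin 2) :
      Rel q (rttL q (upModes gs) (upModes gs) m n i j k l)
        (rttR q (upModes gs) (upModes gs) m n i j k l)
  | ts (m n : ℤ) (i j k l : Fin 2) :
      Rel q (rttL q (downModes gt) (upModes gs) m n i j k l)
        (rttR q (downModes gt) (upModes gs) m n i j k l)
  | t12 : Rel q (gt 0 1 0) 0
  | s21 : Rel q (gs 1 0 0) 0
  | t_mul_s (i : Fin 2) : Rel q (gt i i 0 * gs i i 0) 1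
  | s_mul_t (i : Fin 2) : Rel q (gs i i 0 * gt i i 0) 1

/-- The quantum affine superalgebra `U_q` of `gl(1,1)` (as an algebra). -/
def U (q : ℂ) : Type := RingQuot (Rel q)

instance (q : ℂ) : Ring (U q) := inferInstanceAs (Ring (RingQuot (Rel q)))
instance (q : ℂ) : Algebra ℂ (U q) := inferInstanceAs (Algebra ℂ (RingQuot (Rel q)))

/-- The quotient map from the free algebra. -/
def proj (q : ℂ) : FreeAlgebra ℂ Gen →ₐ[ℂ] U q := RingQuot.mkAlgHom ℂ (Rel q)
/-- The element `s_ij^(n)` of `U`. -/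
def s (q : ℂ) (i j : Fin 2) (n : ℕ) : U q := proj q (gs i j n)

/-- The element `t_ij^(n)` of `U`. -/
def t (q : ℂ) (i j : Fin 2) (n : ℕ) : U q := proj q (gt i j n)

theorem map_rttL {A B : Type*} [Ring A] [Algebra ℂ A] [Ring B] [Algebra ℂ B] (f : A →ₐ[ℂ] B)
    (q : ℂ) (X Y : Fin 2 → Fin 2 → ℤ → A) (m n : ℤ) (i b k d : Fin 2) :
    f (rttL q X Y m n i b k d) =
      rttL q (fun i j k => f (X i j k)) (fun i j k => f (Y i j k)) m n i b k d := by
  simp [rttL]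

theorem map_rttR {A B : Type*} [Ring A] [Algebra ℂ A] [Ring B] [Algebra ℂ B] (f : A →ₐ[ℂ] B)
    (q : ℂ) (X Y : Fin 2 → Fin 2 → ℤ → A) (m n : ℤ) (i b k d : Fin 2) :
    f (rttR q X Y m n i b k d) =
      rttR q (fun i j k => f (X i j k)) (fun i j k => f (Y i j k)) m n i b k d := by
  simp [rttR]

theorem map_upModes {A B : Type*} [Ring A] [Algebra ℂ A] [Ring B] [Algebra ℂ B] (f : A →ₐ[ℂ] B)
    (x : Fin 2 → Fin 2 → ℕ → A) :
    (fun i j k => f (upModes x i j k)) = upModes (fun i j n => f (x i j n)) := by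
  funext i j k; simp only [upModes]; split_ifs <;> simp

theorem map_downModes {A B : Type*} [Ring A] [Algebra ℂ A] [Ring B] [Algebra ℂ B] (f : A →ₐ[ℂ] B)
    (x : Fin 2 → Fin 2 → ℕ → A) :
    (fun i j k => f (downModes x i j k)) = downModes (fun i j n => f (x i j n)) := by
  funext i j k; simp only [downModes]; split_ifs <;> simp

/-- The families `x` (for `s`) and `y` (for `t`) satisfy the defining relations of `U`. -/
structure Sat (q : ℂ) {A : Type*} [Ring A] [Algebra ℂ A] (x y : Fin 2 → Fin 2 → ℕ → A) : Prop where
  tt : ∀ m n i j k l, rttL q (downModes y) (downModes y) m n i j k l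
        = rttR q (downModes y) (downModes y) m n i j k l
  ss : ∀ m n i j k l, rttL q (upModes x) (upModes x) m n i j k l
        = rttR q (upModes x) (upModes x) m n i j k l
  ts : ∀ m n i j k l, rttL q (downModes y) (upModes x) m n i j k l
        = rttR q (downModes y) (upModes x) m n i j k l
  t12 : y 0 1 0 = 0
  s21 : x 1 0 0 = 0
  t_mul_s : ∀ i, y i i 0 * x i i 0 = 1
  s_mul_t : ∀ i, x i i 0 * y i i 0 = 1

/-- The map on generators with `s ↦ x`, `t ↦ y`. -/
def genVal {A : Type*} (x y : Fin 2 → Fin 2 → ℕ → A) : Gen → A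
  | .s i j n => x i j n
  | .t i j n => y i j n

/-- The universal property of `U`. -/
def U.lift (q : ℂ) {A : Type*} [Ring A] [Algebra ℂ A] (x y : Fin 2 → Fin 2 → ℕ → A)
    (h : Sat q x y) : U q →ₐ[ℂ] A :=
  RingQuot.liftAlgHom ℂ ⟨FreeAlgebra.lift ℂ (genVal x y), by
    have hs : (fun i j n => FreeAlgebra.lift ℂ (genVal x y) (gs i j n)) = x := by
      funext i j n; simp [gs, genVal]
    have ht : (fun i j n => FreeAlgebra.lift ℂ (genVal x y) (gt i j n)) = y := by
      funext i j n; simp [gt, genVal]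
    have hs' := fun i j n => congrFun (congrFun (congrFun hs i) j) n
    have ht' := fun i j n => congrFun (congrFun (congrFun ht i) j) n
    intro a b hab
    cases hab with
    | tt m n i j k l => rw [map_rttL, map_rttR, map_downModes, ht]; exact h.tt m n i j k l
    | ss m n i j k l => rw [map_rttL, map_rttR, map_upModes, hs]; exact h.ss m n i j k l
    | ts m n i j k l =>
      rw [map_rttL, map_rttR, map_downModes, map_upModes, hs, ht]; exact h.ts m n i j k l
    | t12 => simpa [ht'] using h.t12
    | s21 => simpa [hs'] using h.s21
    | t_mul_s i => simpa [hs', ht'] using h.t_mul_s i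
    | s_mul_t i => simpa [hs', ht'] using h.s_mul_t i⟩

theorem U.lift_s (q : ℂ) {A : Type*} [Ring A] [Algebra ℂ A] (x y : Fin 2 → Fin 2 → ℕ → A)
    (h : Sat q x y) (i j : Fin 2) (n : ℕ) : U.lift q x y h (s q i j n) = x i j n := by
  refine (RingQuot.liftAlgHom_mkAlgHom_apply ..).trans ?_
  simp [gs, genVal]

theorem U.lift_t (q : ℂ) {A : Type*} [Ring A] [Algebra ℂ A] (x y : Fin 2 → Fin 2 → ℕ → A)
    (h : Sat q x y) (i j : Fin 2) (n : ℕ) : U.lift q x y h (t q i j n) = y i j n := by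
  refine (RingQuot.liftAlgHom_mkAlgHom_apply ..).trans ?_
  simp [gt, genVal]

theorem proj_eq (q : ℂ) {a b} (h : Rel q a b) : proj q a = proj q b :=
  RingQuot.mkAlgHom_rel ℂ h

theorem U.sat (q : ℂ) : Sat q (s q) (t q) where
  tt m n i j k l := by
    have := proj_eq q (Rel.tt m n i j k l)
    rwa [map_rttL, map_rttR, map_downModes] at this
  ss m n i j k l := by
    have := proj_eq q (Rel.ss m n i j k l)
    rwa [map_rttL, map_rttR, map_upModes] at this
  ts m n i j k l := by
    have := proj_eq q (Rel.ts m n i j k l)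
    rwa [map_rttL, map_rttR, map_upModes, map_downModes] at this
  t12 := by simpa [t] using proj_eq q Rel.t12
  s21 := by simpa [s] using proj_eq q Rel.s21
  t_mul_s i := by simpa [s, t] using proj_eq q (Rel.t_mul_s i)
  s_mul_t i := by simpa [s, t] using proj_eq q (Rel.s_mul_t i)

theorem U.hom_ext (q : ℂ) {A : Type*} [Ring A] [Algebra ℂ A] {f g : U q →ₐ[ℂ] A}
    (hs : ∀ i j n, f (s q i j n) = g (s q i j n)) (ht : ∀ i j n, f (t q i j n) = g (t q i j n)) :
    f = g := by
  apply RingQuot.ringQuot_ext'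
  apply FreeAlgebra.hom_ext
  funext x
  cases x with
  | s i j n => exact hs i j n
  | t i j n => exact ht i j n

/-- `(-1)^{|i|+|j|}`. -/
def gsgn (i j : Fin 2) : ℂ := (-1) ^ ((i : ℕ) + j)

theorem Rz_odd (q : ℂ) (i j k l : Fin 2) (h : ((i : ℕ) + j + k + l) % 2 ≠ 0) : Rz q i j k l = 0 := by
  revert h
  fin_cases i <;> fin_cases j <;> fin_cases k <;> fin_cases l <;> simp [Rz]

theorem Rw_odd (q : ℂ) (i j k l : Fin 2) (h : ((i : ℕ) + j + k + l) % 2 ≠ 0) : Rw q i j k l = 0 := by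
  revert h
  fin_cases i <;> fin_cases j <;> fin_cases k <;> fin_cases l <;> simp [Rw]

theorem gsgn_mul (i b k d a c : Fin 2) (h : ((i : ℕ) + a + k + c) % 2 = 0) :
    gsgn a b * gsgn c d = gsgn i b * gsgn k d := by
  have key : ∀ i b k d a c : Fin 2, ((i : ℕ) + a + k + c) % 2 = 0 →
      (-1 : ℤ) ^ ((a : ℕ) + b) * (-1) ^ ((c : ℕ) + d) =
        (-1) ^ ((i : ℕ) + b) * (-1) ^ ((k : ℕ) + d) := by decide +kernel
  simpa [gsgn] using congrArg (Int.cast : ℤ → ℂ) (key i b k d a c h)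

theorem gsgn_mul' (i b k d a c : Fin 2) (h : ((a : ℕ) + b + c + d) % 2 = 0) :
    gsgn k c * gsgn i a = gsgn i b * gsgn k d := by
  have key : ∀ i b k d a c : Fin 2, ((a : ℕ) + b + c + d) % 2 = 0 →
      (-1 : ℤ) ^ ((k : ℕ) + c) * (-1) ^ ((i : ℕ) + a) =
        (-1) ^ ((i : ℕ) + b) * (-1) ^ ((k : ℕ) + d) := by decide +kernel
  simpa [gsgn] using congrArg (Int.cast : ℤ → ℂ) (key i b k d a c h)

theorem rttL_scale {A : Type*} [Ring A] [Algebra ℂ A] (q : ℂ) (X Y : Fin 2 → Fin 2 → ℤ → A)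
    (m n : ℤ) (i b k d : Fin 2) :
    rttL q (fun i j k => gsgn i j • X i j k) (fun i j k => gsgn i j • Y i j k) m n i b k d =
      (gsgn i b * gsgn k d) • rttL q X Y m n i b k d := by
  simp only [rttL, Finset.smul_sum]
  refine Finset.sum_congr rfl fun a _ => Finset.sum_congr rfl fun c _ => ?_
  by_cases hp : ((i : ℕ) + a + k + c) % 2 = 0
  · rw [← gsgn_mul i b k d a c hp]
    simp only [smul_mul_smul_comm]
    rw [smul_comm (Rz q i a k c), smul_comm (Rw q i a k c), ← smul_add, smul_comm]
  · simp [Rz_odd q i a k c hp, Rw_odd q i a k c hp]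

theorem rttR_scale {A : Type*} [Ring A] [Algebra ℂ A] (q : ℂ) (X Y : Fin 2 → Fin 2 → ℤ → A)
    (m n : ℤ) (i b k d : Fin 2) :
    rttR q (fun i j k => gsgn i j • X i j k) (fun i j k => gsgn i j • Y i j k) m n i b k d =
      (gsgn i b * gsgn k d) • rttR q X Y m n i b k d := by
  simp only [rttR, Finset.smul_sum]
  refine Finset.sum_congr rfl fun a _ => Finset.sum_congr rfl fun c _ => ?_
  by_cases hp : ((a : ℕ) + b + c + d) % 2 = 0
  · rw [← gsgn_mul' i b k d a c hp]
    simp only [smul_mul_smul_comm]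
    rw [smul_comm (Rz q a b c d), smul_comm (Rw q a b c d), ← smul_add, smul_comm]
  · simp [Rz_odd q a b c d hp, Rw_odd q a b c d hp]

theorem scale_upModes {A : Type*} [Ring A] [Algebra ℂ A] (x : Fin 2 → Fin 2 → ℕ → A) :
    upModes (fun i j n => gsgn i j • x i j n) = fun i j k => gsgn i j • upModes x i j k := by
  funext i j k; simp only [upModes]; split_ifs <;> simp

theorem scale_downModes {A : Type*} [Ring A] [Algebra ℂ A] (x : Fin 2 → Fin 2 → ℕ → A) :
    downModes (fun i j n => gsgn i j • x i j n) = fun i j k => gsgn i j • downModes x i j k := by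
  funext i j k; simp only [downModes]; split_ifs <;> simp

theorem gsgn_self (i : Fin 2) : gsgn i i = 1 := by
  fin_cases i <;> simp [gsgn]

/-- The parity automorphism `x ↦ (-1)^{|x|} x` of `U`, where `|s_ij^(n)| = |t_ij^(n)| = |i|+|j|`. -/
def parityAut (q : ℂ) : U q →ₐ[ℂ] U q :=
  U.lift q (fun i j n => gsgn i j • s q i j n) (fun i j n => gsgn i j • t q i j n)
    { tt := fun m n i j k l => by
        rw [scale_downModes, rttL_scale, rttR_scale, (U.sat q).tt]
      ss := fun m n i j k l => by
        rw [scale_upModes, rttL_scale, rttR_scale, (U.sat q).ss]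
      ts := fun m n i j k l => by
        rw [scale_upModes, scale_downModes, rttL_scale, rttR_scale, (U.sat q).ts]
      t12 := by rw [(U.sat q).t12, smul_zero]
      s21 := by rw [(U.sat q).s21, smul_zero]
      t_mul_s := fun i => by rw [gsgn_self, one_smul, one_smul, (U.sat q).t_mul_s]
      s_mul_t := fun i => by rw [gsgn_self, one_smul, one_smul, (U.sat q).s_mul_t] }

theorem parityAut_s (q : ℂ) (i j : Fin 2) (n : ℕ) :
    parityAut q (s q i j n) = gsgn i j • s q i j n := U.lift_s ..

theorem parityAut_t (q : ℂ) (i j : Fin 2) (n : ℕ) :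
    parityAut q (t q i j n) = gsgn i j • t q i j n := U.lift_t ..

theorem parityAut_parityAut (q : ℂ) (x : U q) : parityAut q (parityAut q x) = x := by
  have : (parityAut q).comp (parityAut q) = AlgHom.id ℂ (U q) := by
    apply U.hom_ext
    · intro i j n
      simp only [AlgHom.comp_apply, parityAut_s, map_smul, smul_smul]
      fin_cases i <;> fin_cases j <;> simp [gsgn]
    · intro i j n
      simp only [AlgHom.comp_apply, parityAut_t, map_smul, smul_smul]
      fin_cases i <;> fin_cases j <;> simp [gsgn]
  exact congrArg (fun f => f x) this

/-- The `ℤ/2`-grading of `U`: the homogeneous part of parity `p`. -/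
def grade (q : ℂ) (p : ZMod 2) : Submodule ℂ (U q) :=
  LinearMap.eqLocus (parityAut q).toLinearMap (((-1 : ℂ) ^ p.val) • LinearMap.id)

theorem mem_grade (q : ℂ) (p : ZMod 2) (x : U q) :
    x ∈ grade q p ↔ parityAut q x = (-1 : ℂ) ^ p.val • x := Iff.rfl

theorem mem_grade_zero (q : ℂ) (x : U q) : x ∈ grade q 0 ↔ parityAut q x = x := by
  simp [mem_grade]

theorem mem_grade_one (q : ℂ) (x : U q) : x ∈ grade q 1 ↔ parityAut q x = -x := by
  simp [mem_grade, ZMod.val_one]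

instance (q : ℂ) : SetLike.GradedMonoid (grade q) where
  one_mem := by simp [mem_grade]
  mul_mem i j x y hx hy := by
    rw [mem_grade] at *
    rw [map_mul, hx, hy, smul_mul_smul_comm]
    congr 1
    rw [ZMod.val_add, ← neg_one_pow_eq_pow_mod_two, pow_add]

/-- Even part of an element. -/
def evenPart (q : ℂ) : U q →ₗ[ℂ] grade q 0 :=
  LinearMap.codRestrict _ ((2⁻¹ : ℂ) • (LinearMap.id + (parityAut q).toLinearMap)) fun x => by
    simp [mem_grade_zero, parityAut_parityAut, add_comm]

/-- Odd part of an element. -/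
def oddPart (q : ℂ) : U q →ₗ[ℂ] grade q 1 :=
  LinearMap.codRestrict _ ((2⁻¹ : ℂ) • (LinearMap.id - (parityAut q).toLinearMap)) fun x => by
    simp [mem_grade_one, parityAut_parityAut]

theorem coe_evenPart (q : ℂ) (x : U q) :
    (evenPart q x : U q) = (2⁻¹ : ℂ) • (x + parityAut q x) := rfl

theorem coe_oddPart (q : ℂ) (x : U q) :
    (oddPart q x : U q) = (2⁻¹ : ℂ) • (x - parityAut q x) := rfl

theorem half_add_half {V : Type*} [AddCommGroup V] [Module ℂ V] (x : V) :
    (2⁻¹ : ℂ) • (x + x) = x := by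
  rw [← two_smul ℂ x, smul_smul]; norm_num

instance (q : ℂ) : DirectSum.Decomposition (grade q) :=
  DirectSum.Decomposition.ofLinearMap (grade q)
    ((DirectSum.lof ℂ (ZMod 2) (fun i => grade q i) 0).comp (evenPart q) +
      (DirectSum.lof ℂ (ZMod 2) (fun i => grade q i) 1).comp (oddPart q))
    (by
      ext x
      simp only [LinearMap.comp_apply, LinearMap.add_apply, map_add, DirectSum.coeLinearMap_lof,
        coe_evenPart, coe_oddPart, LinearMap.id_apply]
      rw [← smul_add, add_add_sub_cancel, half_add_half])
    (by
      ext i x : 2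
      obtain ⟨x, hx⟩ := x
      have hi : i = 0 ∨ i = 1 := (by decide : ∀ i : ZMod 2, i = 0 ∨ i = 1) i
      rcases hi with rfl | rfl
      · have hx' := (mem_grade_zero q x).1 hx
        have h1 : evenPart q x = ⟨x, hx⟩ := by
          ext; rw [coe_evenPart, hx', half_add_half]
        have h2 : oddPart q x = 0 := by
          ext; rw [coe_oddPart, hx', sub_self, smul_zero]; rfl
        simp only [LinearMap.comp_apply, LinearMap.add_apply, DirectSum.coeLinearMap_lof, h1, h2,
          map_zero, add_zero, LinearMap.id_apply]
      · have hx' := (mem_grade_one q x).1 hx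
        have h1 : evenPart q x = 0 := by
          ext; rw [coe_evenPart, hx', add_neg_cancel, smul_zero]; rfl
        have h2 : oddPart q x = ⟨x, hx⟩ := by
          ext; rw [coe_oddPart, hx', sub_neg_eq_add, half_add_half]
        simp only [LinearMap.comp_apply, LinearMap.add_apply, DirectSum.coeLinearMap_lof, h1, h2,
          map_zero, zero_add, LinearMap.id_apply])

instance (q : ℂ) : GradedAlgebra (grade q) where


/-- Integer version of `sgn`. -/
def sgnZ (i j k l : Fin 2) : ℤ := (-1) ^ (((i : ℕ) + j) * ((k : ℕ) + l))

theorem sgn_eq (i j k l : Fin 2) : sgn i j k l = (sgnZ i j k l : ℂ) := by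
  simp [sgn, sgnZ]

/-- An auxiliary sign. -/
def tauZ (i k e f b d : Fin 2) : ℤ :=
  (-1) ^ (((e : ℕ) + b) * ((f : ℕ) + d + i + e) + ((i : ℕ) + e + k + f) * ((f : ℕ) + d))

/-- An auxiliary sign. -/
def tauZ' (i k a c b d : Fin 2) : ℤ :=
  tauZ i k 0 (a + c) b d * sgnZ k c a 0 * sgnZ 0 b c d

theorem sign1 : ∀ i k a c e f b d : Fin 2, ((i : ℕ) + a + k + c) % 2 = 0 →
    sgnZ a b k d * (sgnZ a e e b * (sgnZ c f f d * sgnZ e b c f)) =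
      tauZ i k e f b d * sgnZ a e k f := by
  decide +kernel

theorem sign2 : ∀ i k a c e f b d : Fin 2, ((a : ℕ) + e + c + f) % 2 = 0 →
    tauZ i k e f b d * sgnZ k c a e = tauZ' i k a c b d * sgnZ e b c d := by
  decide +kernel

theorem sign3 : ∀ i k a c e f b d : Fin 2, ((e : ℕ) + b + f + d) % 2 = 0 →
    tauZ' i k a c b d * (sgnZ c f e b * sgnZ c f i a) =
      sgnZ k f e b * (sgnZ k c c f * sgnZ i a a e) := by
  decide +kernel

/-- If `A, B` and `A', B'` satisfy an RTT relation and supercommute with each other, then so do the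
products `A A'`, `B B'`. -/
theorem rtt_mul {P : Type*} [Ring P] [Algebra ℂ P] (ρ : Fin 2 → Fin 2 → Fin 2 → Fin 2 → P)
    (hc : ∀ i j k l x, ρ i j k l * x = x * ρ i j k l)
    (h0 : ∀ i j k l : Fin 2, ((i : ℕ) + j + k + l) % 2 ≠ 0 → ρ i j k l = 0)
    (A A' B B' : Fin 2 → Fin 2 → P)
    (h : ∀ i b k d, ∑ a, ∑ c, sgn a b k d • (ρ i a k c * (A a b * B c d)) =
      ∑ a, ∑ c, sgn k c a b • (B k c * A i a * ρ a b c d))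
    (h' : ∀ i b k d, ∑ a, ∑ c, sgn a b k d • (ρ i a k c * (A' a b * B' c d)) =
      ∑ a, ∑ c, sgn k c a b • (B' k c * A' i a * ρ a b c d))
    (hA'B : ∀ a b c d, A' a b * B c d = sgn a b c d • (B c d * A' a b))
    (hB'A : ∀ a b c d, B' a b * A c d = sgn a b c d • (A c d * B' a b))
    (i b k d : Fin 2) :
    ∑ a, ∑ c, sgn a b k d • (ρ i a k c *
        ((∑ e, sgn a e e b • (A a e * A' e b)) * (∑ f, sgn c f f d • (B c f * B' f d)))) =
      ∑ e, ∑ f, sgn k f e b •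
        ((∑ c, sgn k c c f • (B k c * B' c f)) * (∑ a, sgn i a a e • (A i a * A' a e)) *
          ρ e b f d) := by
  have e1 : ∀ a c e f, sgn a b k d • (ρ i a k c *
      ((sgn a e e b • (A a e * A' e b)) * (sgn c f f d • (B c f * B' f d)))) =
      (tauZ i k e f b d : ℂ) • ((sgn a e k f • (ρ i a k c * (A a e * B c f))) *
        (A' e b * B' f d)) := by
    intro a c e f
    by_cases hp : ((i : ℕ) + a + k + c) % 2 = 0
    · have := congrArg (Int.cast : ℤ → ℂ) (sign1 i k a c e f b d hp)
      push_cast at this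
      simp only [← sgn_eq] at this
      calc _ = (sgn a b k d * (sgn a e e b * sgn c f f d)) •
            (ρ i a k c * (A a e * (A' e b * B c f) * B' f d)) := by
              simp only [mul_assoc, smul_mul_assoc, mul_smul_comm, smul_smul] <;> (congr 1; ring)
        _ = (sgn a b k d * (sgn a e e b * (sgn c f f d * sgn e b c f))) •
            (ρ i a k c * (A a e * (B c f * A' e b) * B' f d)) := by
              rw [hA'B]
              simp only [mul_assoc, smul_mul_assoc, mul_smul_comm, smul_smul] <;> (congr 1; ring)
        _ = _ := by
              rw [this]
              simp only [mul_assoc, smul_mul_assoc, mul_smul_comm, smul_smul] <;> (congr 1; ring)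
    · rw [h0 _ _ _ _ hp]; simp
  have e2 : ∀ a c e f, (tauZ i k e f b d : ℂ) • ((sgn k c a e • (B k c * A i a * ρ a e c f)) *
        (A' e b * B' f d)) = (tauZ' i k a c b d : ℂ) • ((B k c * A i a) *
          (sgn e b c d • (ρ a e c f * (A' e b * B' f d)))) := by
    intro a c e f
    by_cases hp : ((a : ℕ) + e + c + f) % 2 = 0
    · have := congrArg (Int.cast : ℤ → ℂ) (sign2 i k a c e f b d hp)
      push_cast at this
      simp only [← sgn_eq] at this
      simp only [mul_assoc, smul_mul_assoc, mul_smul_comm, smul_smul, this]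
    · rw [h0 _ _ _ _ hp]; simp
  have e3 : ∀ a c e f, (tauZ' i k a c b d : ℂ) • ((B k c * A i a) *
          (sgn c f e b • (B' c f * A' a e * ρ e b f d))) =
      sgn k f e b • ((sgn k c c f • (B k c * B' c f)) *
        (sgn i a a e • (A i a * A' a e)) * ρ e b f d) := by
    intro a c e f
    by_cases hp : ((e : ℕ) + b + f + d) % 2 = 0
    · have := congrArg (Int.cast : ℤ → ℂ) (sign3 i k a c e f b d hp)
      push_cast at this
      simp only [← sgn_eq] at this
      have sq : sgn c f i a * sgn c f i a = 1 := by
        rw [sgn, ← mul_pow]; simp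
      have sw : A i a * B' c f = sgn c f i a • (B' c f * A i a) := by
        rw [hB'A, smul_smul, sq, one_smul]
      calc _ = ((tauZ' i k a c b d : ℂ) * sgn c f e b) •
              (B k c * (A i a * B' c f) * A' a e * ρ e b f d) := by
              simp only [mul_assoc, smul_mul_assoc, mul_smul_comm, smul_smul] <;> (congr 1; ring)
        _ = ((tauZ' i k a c b d : ℂ) * (sgn c f e b * sgn c f i a)) •
              (B k c * (B' c f * A i a) * A' a e * ρ e b f d) := by
              rw [sw]
              simp only [mul_assoc, smul_mul_assoc, mul_smul_comm, smul_smul] <;> (congr 1; ring)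
        _ = _ := by
              rw [this]
              simp only [mul_assoc, smul_mul_assoc, mul_smul_comm, smul_smul] <;> (congr 1; ring)
    · rw [h0 _ _ _ _ hp]; simp
  calc _ = ∑ a, ∑ c, ∑ e, ∑ f, sgn a b k d • (ρ i a k c *
      ((sgn a e e b • (A a e * A' e b)) * (sgn c f f d • (B c f * B' f d)))) := by
        refine Finset.sum_congr rfl fun a _ => Finset.sum_congr rfl fun c _ => ?_
        rw [Finset.sum_mul_sum]
        simp only [Finset.mul_sum, Finset.smul_sum]
    _ = ∑ e, ∑ f, ∑ a, ∑ c, (tauZ i k e f b d : ℂ) •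
        ((sgn a e k f • (ρ i a k c * (A a e * B c f))) * (A' e b * B' f d)) := by
        simp only [e1, Fin.sum_univ_two]; abel
    _ = ∑ e, ∑ f, (tauZ i k e f b d : ℂ) •
        ((∑ a, ∑ c, sgn a e k f • (ρ i a k c * (A a e * B c f))) * (A' e b * B' f d)) := by
        simp only [Finset.sum_mul, Finset.smul_sum]
    _ = ∑ e, ∑ f, ∑ a, ∑ c, (tauZ i k e f b d : ℂ) •
        ((sgn k c a e • (B k c * A i a * ρ a e c f)) * (A' e b * B' f d)) := by
        simp only [h, Finset.sum_mul, Finset.smul_sum]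
    _ = ∑ a, ∑ c, ∑ e, ∑ f, (tauZ' i k a c b d : ℂ) • ((B k c * A i a) *
          (sgn e b c d • (ρ a e c f * (A' e b * B' f d)))) := by
        simp only [e2, Fin.sum_univ_two]; abel
    _ = ∑ a, ∑ c, (tauZ' i k a c b d : ℂ) • ((B k c * A i a) *
          (∑ e, ∑ f, sgn e b c d • (ρ a e c f * (A' e b * B' f d)))) := by
        simp only [Finset.mul_sum, Finset.smul_sum]
    _ = ∑ a, ∑ c, ∑ e, ∑ f, (tauZ' i k a c b d : ℂ) • ((B k c * A i a) *
          (sgn c f e b • (B' c f * A' a e * ρ e b f d))) := by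
        simp only [h', Finset.mul_sum, Finset.smul_sum]
    _ = ∑ e, ∑ f, ∑ c, ∑ a, sgn k f e b • ((sgn k c c f • (B k c * B' c f)) *
        (sgn i a a e • (A i a * A' a e)) * ρ e b f d) := by
        simp only [e3, Fin.sum_univ_two]; abel
    _ = _ := by
        refine Finset.sum_congr rfl fun a _ => Finset.sum_congr rfl fun c _ => ?_
        rw [Finset.sum_mul_sum]
        simp only [Finset.sum_mul, Finset.smul_sum]

end

noncomputable section

open PowerSeries

/-- The series `∑ a_n z^n` in `X⟦w⟧⟦z⟧`. -/
def inZ {X : Type*} [Ring X] (a : ℕ → X) : X⟦X⟧⟦X⟧ := PowerSeries.map PowerSeries.C (mk a)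

/-- The series `∑ a_n w^n` in `X⟦w⟧⟦z⟧`. -/
def inW {X : Type*} [Ring X] (a : ℕ → X) : X⟦X⟧⟦X⟧ := PowerSeries.C (mk a)

section
variable {X : Type*} [Ring X]

theorem coeff_inZ_inW (a b : ℕ → X) (m n : ℕ) :
    coeff n (coeff m (inZ a * inW b)) = a m * b n := by
  simp [inZ, inW, coeff_mul_C, coeff_C_mul]

theorem coeff_inW_inZ (a b : ℕ → X) (m n : ℕ) :
    coeff n (coeff m (inW b * inZ a)) = b n * a m := by
  simp [inZ, inW, coeff_mul_C, coeff_C_mul]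

/-- The variable `z`. -/
def zz : X⟦X⟧⟦X⟧ := PowerSeries.X

/-- The variable `w`. -/
def ww : X⟦X⟧⟦X⟧ := PowerSeries.C PowerSeries.X

theorem zz_comm (x : X⟦X⟧⟦X⟧) : zz * x = x * zz := (commute_X x).symm.eq
theorem ww_comm (x : X⟦X⟧⟦X⟧) : ww * x = x * ww := by
  ext m n
  simp [ww, coeff_C_mul, coeff_mul_C, (commute_X _).eq]

theorem coeff_zz_mul (x : X⟦X⟧⟦X⟧) (m n : ℕ) :
    coeff n (coeff m (zz * x)) = if m = 0 then 0 else coeff n (coeff (m - 1) x) := by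
  cases m <;> simp [zz, coeff_succ_X_mul]

theorem coeff_ww_mul (x : X⟦X⟧⟦X⟧) (m n : ℕ) :
    coeff n (coeff m (ww * x)) = if n = 0 then 0 else coeff (n - 1) (coeff m x) := by
  cases n <;> simp [ww, coeff_C_mul, coeff_succ_X_mul]
end
section coproduct

/-- A translation between modes indexed by integers and bivariate power series, for `R(z,w)` rescaled
by a monomial to `α R' + β R''`. -/
structure Shape {A : Type*} [Ring A] (α β : A⟦X⟧⟦X⟧)
    (mx my : (Fin 2 → Fin 2 → ℕ → A) → Fin 2 → Fin 2 → ℤ → A) (μ ν : ℕ → ℤ) : Prop where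
  cα : ∀ x, α * x = x * α
  cβ : ∀ x, β * x = x * β
  hα : ∀ a b m n i j k l, coeff n (coeff m (α * (inZ (a i j) * inW (b k l)))) =
    mx a i j (μ m - 1) * my b k l (ν n)
  hβ : ∀ a b m n i j k l, coeff n (coeff m (β * (inZ (a i j) * inW (b k l)))) =
    mx a i j (μ m) * my b k l (ν n - 1)
  hα' : ∀ a b m n i j k l, coeff n (coeff m (α * (inW (b k l) * inZ (a i j)))) =
    my b k l (ν n) * mx a i j (μ m - 1)
  hβ' : ∀ a b m n i j k l, coeff n (coeff m (β * (inW (b k l) * inZ (a i j)))) =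
    my b k l (ν n - 1) * mx a i j (μ m)
  outX : ∀ a i j M, (∀ m, μ m ≠ M) → mx a i j M = 0 ∧ mx a i j (M - 1) = 0
  outY : ∀ b i j N, (∀ n, ν n ≠ N) → my b i j N = 0 ∧ my b i j (N - 1) = 0

variable {A : Type*} [Ring A]

theorem shape_ss : Shape (A := A) zz ww upModes upModes (fun m => m) (fun n => n) where
  cα := zz_comm
  cβ := ww_comm
  hα a b m n i j k l := by
    rw [coeff_zz_mul, coeff_inZ_inW]
    rcases m with _ | m <;> simp [upModes]
  hα' a b m n i j k l := by
    rw [coeff_zz_mul, coeff_inW_inZ]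
    rcases m with _ | m <;> simp [upModes]
  hβ a b m n i j k l := by
    rw [coeff_ww_mul, coeff_inZ_inW]
    rcases n with _ | n <;> simp [upModes]
  hβ' a b m n i j k l := by
    rw [coeff_ww_mul, coeff_inW_inZ]
    rcases n with _ | n <;> simp [upModes]
  outX a i j M h := by
    have : M < 0 := by
      by_contra hM
      exact h M.toNat (Int.toNat_of_nonneg (not_lt.1 hM))
    simp only [upModes]
    rw [if_neg (by omega), if_neg (by omega)]; simp
  outY a i j M h := by
    have : M < 0 := by
      by_contra hM
      exact h M.toNat (Int.toNat_of_nonneg (not_lt.1 hM))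
    simp only [upModes]
    rw [if_neg (by omega), if_neg (by omega)]; simp

theorem downModes_out (a : Fin 2 → Fin 2 → ℕ → A) (i j : Fin 2) (M : ℤ)
    (h : ∀ m : ℕ, 1 - (m : ℤ) ≠ M) : downModes a i j M = 0 ∧ downModes a i j (M - 1) = 0 := by
  have : 1 < M := by
    by_contra hM
    exact h (1 - M).toNat (by rw [Int.toNat_of_nonneg (by omega)]; omega)
  simp only [downModes]
  rw [if_neg (by omega), if_neg (by omega)]; simp

theorem downModes_one_sub (a : Fin 2 → Fin 2 → ℕ → A) (i j : Fin 2) (m : ℕ) :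
    downModes a i j (1 - m) = if m = 0 then 0 else a i j (m - 1) := by
  rcases m with _ | m
  · simp [downModes]
  · simp [downModes]

theorem downModes_one_sub_sub (a : Fin 2 → Fin 2 → ℕ → A) (i j : Fin 2) (m : ℕ) :
    downModes a i j (1 - m - 1) = a i j m := by
  have : (1 - m - 1 : ℤ) = -m := by ring
  simp [downModes, this]

theorem upModes_cast (a : Fin 2 → Fin 2 → ℕ → A) (i j : Fin 2) (m : ℕ) :
    upModes a i j m = a i j m := by
  simp [upModes]

theorem upModes_cast_sub (a : Fin 2 → Fin 2 → ℕ → A) (i j : Fin 2) (m : ℕ) :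
    upModes a i j (m - 1) = if m = 0 then 0 else a i j (m - 1) := by
  rcases m with _ | m <;> simp [upModes]

theorem shape_tt : Shape (A := A) ww zz downModes downModes (fun m => 1 - m) (fun n => 1 - n) where
  cα := ww_comm
  cβ := zz_comm
  hα a b m n i j k l := by
    rw [coeff_ww_mul, coeff_inZ_inW, downModes_one_sub_sub, downModes_one_sub]; simp
  hα' a b m n i j k l := by
    rw [coeff_ww_mul, coeff_inW_inZ, downModes_one_sub_sub, downModes_one_sub]; simp
  hβ a b m n i j k l := by
    rw [coeff_zz_mul, coeff_inZ_inW, downModes_one_sub_sub, downModes_one_sub]; simp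
  hβ' a b m n i j k l := by
    rw [coeff_zz_mul, coeff_inW_inZ, downModes_one_sub_sub, downModes_one_sub]; simp
  outX a i j M h := downModes_out a i j M h
  outY a i j M h := downModes_out a i j M h

theorem shape_ts : Shape (A := A) 1 (zz * ww) downModes upModes (fun m => 1 - m) (fun n => n) where
  cα := by simp
  cβ x := by rw [mul_assoc, ww_comm, ← mul_assoc, zz_comm, mul_assoc]
  hα a b m n i j k l := by
    rw [one_mul, coeff_inZ_inW, downModes_one_sub_sub, upModes_cast]
  hα' a b m n i j k l := by
    rw [one_mul, coeff_inW_inZ, downModes_one_sub_sub, upModes_cast]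
  hβ a b m n i j k l := by
    rw [mul_assoc, coeff_zz_mul, coeff_ww_mul, coeff_inZ_inW, downModes_one_sub, upModes_cast_sub]
    split_ifs <;> simp
  hβ' a b m n i j k l := by
    rw [mul_assoc, coeff_zz_mul, coeff_ww_mul, coeff_inW_inZ, downModes_one_sub, upModes_cast_sub]
    split_ifs <;> simp
  outX a i j M h := downModes_out a i j M h
  outY := shape_ss.outY

variable [Algebra ℂ A]

/-- The coefficients of `α R' + β R''`. -/
def rho (q : ℂ) (α β : A⟦X⟧⟦X⟧) (i j k l : Fin 2) : A⟦X⟧⟦X⟧ := Rz q i j k l • α + Rw q i j k l • β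

theorem rho_comm (q : ℂ) {α β : A⟦X⟧⟦X⟧} (cα : ∀ x, α * x = x * α) (cβ : ∀ x, β * x = x * β)
    (i j k l : Fin 2) (x : A⟦X⟧⟦X⟧) : rho q α β i j k l * x = x * rho q α β i j k l := by
  simp only [rho, add_mul, mul_add, smul_mul_assoc, mul_smul_comm, cα, cβ]

theorem coeff_smul2 (c : ℂ) (x : A⟦X⟧⟦X⟧) (m n : ℕ) :
    coeff n (coeff m (c • x)) = c • coeff n (coeff m x) := by
  simp [PowerSeries.coeff_smul]

theorem Shape.iff {α β : A⟦X⟧⟦X⟧} {mx my : (Fin 2 → Fin 2 → ℕ → A) → Fin 2 → Fin 2 → ℤ → A}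
    {μ ν : ℕ → ℤ} (S : Shape α β mx my μ ν) (q : ℂ) (x y : Fin 2 → Fin 2 → ℕ → A) :
    (∀ i b k d, ∑ a, ∑ c, sgn a b k d • (rho q α β i a k c * (inZ (x a b) * inW (y c d))) =
      ∑ a, ∑ c, sgn k c a b • (inW (y k c) * inZ (x i a) * rho q α β a b c d)) ↔
    ∀ m n i b k d, rttL q (mx x) (my y) m n i b k d = rttR q (mx x) (my y) m n i b k d := by
  have hL : ∀ i b k d m n, coeff n (coeff m
      (∑ a, ∑ c, sgn a b k d • (rho q α β i a k c * (inZ (x a b) * inW (y c d))))) =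
      rttL q (mx x) (my y) (μ m) (ν n) i b k d := by
    intro i b k d m n
    simp only [map_sum, coeff_smul2, rho, add_mul, smul_mul_assoc, map_add, S.hα, S.hβ, rttL]
  have hR : ∀ i b k d m n, coeff n (coeff m
      (∑ a, ∑ c, sgn k c a b • (inW (y k c) * inZ (x i a) * rho q α β a b c d))) =
      rttR q (mx x) (my y) (μ m) (ν n) i b k d := by
    intro i b k d m n
    simp only [← rho_comm q S.cα S.cβ]
    simp only [map_sum, coeff_smul2, rho, add_mul, smul_mul_assoc, map_add, S.hα', S.hβ', rttR]
  constructor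
  · intro h m n i b k d
    by_cases hm : ∃ m', μ m' = m
    · by_cases hn : ∃ n', ν n' = n
      · obtain ⟨m', rfl⟩ := hm
        obtain ⟨n', rfl⟩ := hn
        rw [← hL, ← hR, h]
      · have := fun i j => S.outY y i j n (by simpa using hn)
        simp [rttL, rttR, this]
    · have := fun i j => S.outX x i j m (by simpa using hm)
      simp [rttL, rttR, this]
  · intro h i b k d
    ext m n
    rw [hL, hR, h]

/-- The family `n ↦ ∑_k ε(i,j,k) ∑_{a+b=n} x_ik^(a) x'_kj^(b)`, `ε(i,j,k) = (-1)^{(|i|+|k|)(|k|+|j|)}`. -/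
def comul2 (x x' : Fin 2 → Fin 2 → ℕ → A) (i j : Fin 2) (n : ℕ) : A :=
  ∑ k, sgn i k k j • ∑ p ∈ Finset.HasAntidiagonal.antidiagonal n, x i k p.1 * x' k j p.2

theorem mk_comul2 (x x' : Fin 2 → Fin 2 → ℕ → A) (i j : Fin 2) :
    mk (comul2 x x' i j) = ∑ k, sgn i k k j • (mk (x i k) * mk (x' k j)) := by
  ext n
  simp [comul2, coeff_mul, PowerSeries.coeff_smul]

theorem map_C_smul (c : ℂ) (f : A⟦X⟧) :
    PowerSeries.map (PowerSeries.C (R := A)) (c • f) = c • PowerSeries.map PowerSeries.C f := by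
  ext m n
  rw [coeff_smul2, coeff_map, coeff_map, PowerSeries.coeff_C, PowerSeries.coeff_C]
  split_ifs <;> simp

theorem C_smul2 (c : ℂ) (f : A⟦X⟧) :
    PowerSeries.C (R := A⟦X⟧) (c • f) = c • PowerSeries.C f := by
  ext m n
  rw [coeff_smul2, PowerSeries.coeff_C, PowerSeries.coeff_C]
  split_ifs <;> simp

theorem inZ_comul2 (x x' : Fin 2 → Fin 2 → ℕ → A) (i j : Fin 2) :
    inZ (comul2 x x' i j) = ∑ k, sgn i k k j • (inZ (x i k) * inZ (x' k j)) := by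
  simp only [inZ, mk_comul2, map_sum, map_C_smul, map_mul]

theorem inW_comul2 (x x' : Fin 2 → Fin 2 → ℕ → A) (i j : Fin 2) :
    inW (comul2 x x' i j) = ∑ k, sgn i k k j • (inW (x i k) * inW (x' k j)) := by
  simp only [inW, mk_comul2, map_sum, C_smul2, map_mul]

theorem Shape.comul {α β : A⟦X⟧⟦X⟧} {mx my : (Fin 2 → Fin 2 → ℕ → A) → Fin 2 → Fin 2 → ℤ → A}
    {μ ν : ℕ → ℤ} (S : Shape α β mx my μ ν) (q : ℂ) (x x' y y' : Fin 2 → Fin 2 → ℕ → A)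
    (h : ∀ m n i b k d, rttL q (mx x) (my y) m n i b k d = rttR q (mx x) (my y) m n i b k d)
    (h' : ∀ m n i b k d, rttL q (mx x') (my y') m n i b k d = rttR q (mx x') (my y') m n i b k d)
    (hx'y : ∀ a b c d m n, x' a b m * y c d n = sgn a b c d • (y c d n * x' a b m))
    (hy'x : ∀ a b c d m n, y' a b n * x c d m = sgn a b c d • (x c d m * y' a b n)) :
    ∀ m n i b k d, rttL q (mx (comul2 x x')) (my (comul2 y y')) m n i b k d =
      rttR q (mx (comul2 x x')) (my (comul2 y y')) m n i b k d := by
  rw [← S.iff]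
  intro i b k d
  simp only [inZ_comul2, inW_comul2]
  refine rtt_mul (rho q α β) (rho_comm q S.cα S.cβ) ?_ (fun i j => inZ (x i j))
    (fun i j => inZ (x' i j)) (fun i j => inW (y i j)) (fun i j => inW (y' i j))
    ((S.iff q x y).2 h) ((S.iff q x' y').2 h') ?_ ?_ i b k d
  · intro i j k l hp
    simp [rho, Rz_odd q i j k l hp, Rw_odd q i j k l hp]
  · intro a b c d
    ext m n
    rw [coeff_smul2, coeff_inZ_inW, coeff_inW_inZ, hx'y]
  · intro a b c d
    ext m n
    rw [coeff_smul2, coeff_inZ_inW, coeff_inW_inZ, hy'x]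

theorem Sat.comul {q : ℂ} {x x' y y' : Fin 2 → Fin 2 → ℕ → A} (h : Sat q x y) (h' : Sat q x' y')
    (hxx : ∀ a b c d m n, x' a b m * x c d n = sgn a b c d • (x c d n * x' a b m))
    (hxy : ∀ a b c d m n, x' a b m * y c d n = sgn a b c d • (y c d n * x' a b m))
    (hyx : ∀ a b c d m n, y' a b m * x c d n = sgn a b c d • (x c d n * y' a b m))
    (hyy : ∀ a b c d m n, y' a b m * y c d n = sgn a b c d • (y c d n * y' a b m)) :
    Sat q (comul2 x x') (comul2 y y') where
  tt := shape_tt.comul q y y' y y' h.tt h'.tt hyy (fun a b c d m n => hyy a b c d n m)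
  ss := shape_ss.comul q x x' x x' h.ss h'.ss hxx (fun a b c d m n => hxx a b c d n m)
  ts := shape_ts.comul q y y' x x' h.ts h'.ts hyx (fun a b c d m n => hxy a b c d n m)
  t12 := by simp [comul2, h.t12, h'.t12]
  s21 := by simp [comul2, h.s21, h'.s21]
  t_mul_s i := by
    have e1 := h.t_mul_s i
    have e2 := h'.t_mul_s i
    have e3 := hyx i i i i 0 0
    have e4 : sgn i i i i = 1 := by fin_cases i <;> norm_num [sgn]
    have e5 : comul2 x x' i i 0 = x i i 0 * x' i i 0 := by
      fin_cases i <;> norm_num [comul2, h.s21, h'.s21, sgn]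
    have e6 : comul2 y y' i i 0 = y i i 0 * y' i i 0 := by
      fin_cases i <;> norm_num [comul2, h.t12, h'.t12, sgn]
    rw [e4, one_smul] at e3
    rw [e5, e6, mul_assoc, ← mul_assoc (y' i i 0), e3, mul_assoc, e2, mul_one, e1]
  s_mul_t i := by
    have e1 := h.s_mul_t i
    have e2 := h'.s_mul_t i
    have e3 := hxy i i i i 0 0
    have e4 : sgn i i i i = 1 := by fin_cases i <;> norm_num [sgn]
    have e5 : comul2 x x' i i 0 = x i i 0 * x' i i 0 := by
      fin_cases i <;> norm_num [comul2, h.s21, h'.s21, sgn]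
    have e6 : comul2 y y' i i 0 = y i i 0 * y' i i 0 := by
      fin_cases i <;> norm_num [comul2, h.t12, h'.t12, sgn]
    rw [e4, one_smul] at e3
    rw [e5, e6, mul_assoc, ← mul_assoc (x' i i 0), e3, mul_assoc, e2, mul_one, e1]



/-- The tensor product of superalgebras `U ⊗ U`, with
`(x ⊗ y)(x' ⊗ y') = (-1)^{|y||x'|} xx' ⊗ yy'` for homogeneous `y`, `x'`. -/
abbrev U2 (q : ℂ) : Type := grade q ᵍ⊗[ℂ] grade q

theorem gsgn_pow (i j : Fin 2) : gsgn i j = (-1) ^ (((i : ℕ) + (j : ℕ) : ℕ) : ZMod 2).val := by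
  rw [ZMod.val_natCast, ← neg_one_pow_eq_pow_mod_two, gsgn]

theorem s_mem (q : ℂ) (i j : Fin 2) (n : ℕ) : s q i j n ∈ grade q (((i : ℕ) + (j : ℕ) : ℕ) : ZMod 2) := by
  rw [mem_grade, parityAut_s, gsgn_pow]

theorem t_mem (q : ℂ) (i j : Fin 2) (n : ℕ) : t q i j n ∈ grade q (((i : ℕ) + (j : ℕ) : ℕ) : ZMod 2) := by
  rw [mem_grade, parityAut_t, gsgn_pow]

theorem swap (q : ℂ) (a b c d : Fin 2) (x y : U q)
    (hx : x ∈ grade q (((a : ℕ) + (b : ℕ) : ℕ) : ZMod 2))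
    (hy : y ∈ grade q (((c : ℕ) + (d : ℕ) : ℕ) : ZMod 2)) :
    (GradedTensorProduct.tmul ℂ 1 x : U2 q) * GradedTensorProduct.tmul ℂ y 1 =
      sgn a b c d • (GradedTensorProduct.tmul ℂ y 1 * GradedTensorProduct.tmul ℂ 1 x : U2 q) := by
  have h1 := GradedTensorProduct.tmul_coe_mul_coe_tmul (R := ℂ) (𝒜 := grade q) (ℬ := grade q)
    (1 : U q) ⟨x, hx⟩ ⟨y, hy⟩ (1 : U q)
  have h2 := GradedTensorProduct.tmul_one_mul_one_tmul (R := ℂ) (𝒜 := grade q) (ℬ := grade q) y x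
  simp only [one_mul, mul_one] at h1
  rw [h1, h2]
  rw [← Nat.cast_mul]
  have key : ∀ (N : ℕ) (v : U2 q), ((-1 : ℤˣ) ^ (N : ZMod 2)) • v = ((-1 : ℂ) ^ N) • v := by
    intro N v
    rw [uzpow_natCast, Units.smul_def, ← Int.cast_smul_eq_zsmul ℂ]
    simp
  rw [key, sgn, mul_comm]

theorem Sat.map {A B : Type*} [Ring A] [Algebra ℂ A] [Ring B] [Algebra ℂ B] {q : ℂ}
    {x y : Fin 2 → Fin 2 → ℕ → A} (h : Sat q x y) (f : A →ₐ[ℂ] B) :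
    Sat q (fun i j n => f (x i j n)) (fun i j n => f (y i j n)) where
  tt m n i j k l := by
    rw [← map_downModes, ← map_rttL, h.tt, map_rttR]
  ss m n i j k l := by
    rw [← map_upModes, ← map_rttL, h.ss, map_rttR]
  ts m n i j k l := by
    rw [← map_upModes, ← map_downModes, ← map_rttL, h.ts, map_rttR]
  t12 := by rw [h.t12, map_zero]
  s21 := by rw [h.s21, map_zero]
  t_mul_s i := by rw [← map_mul, h.t_mul_s, map_one]
  s_mul_t i := by rw [← map_mul, h.s_mul_t, map_one]

/-- `x ↦ x ⊗ 1`. -/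
def inclL (q : ℂ) : U q →ₐ[ℂ] U2 q := GradedTensorProduct.includeLeft (grade q) (grade q)

/-- `x ↦ 1 ⊗ x`. -/
def inclR (q : ℂ) : U q →ₐ[ℂ] U2 q := GradedTensorProduct.includeRight (grade q) (grade q)

theorem sat_comul (q : ℂ) :
    Sat q (comul2 (fun i j n => inclL q (s q i j n)) (fun i j n => inclR q (s q i j n)))
      (comul2 (fun i j n => inclL q (t q i j n)) (fun i j n => inclR q (t q i j n))) :=
  ((U.sat q).map (inclL q)).comul ((U.sat q).map (inclR q))
    (fun a b c d m n => swap q a b c d _ _ (s_mem q a b m) (s_mem q c d n))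
    (fun a b c d m n => swap q a b c d _ _ (s_mem q a b m) (t_mem q c d n))
    (fun a b c d m n => swap q a b c d _ _ (t_mem q a b m) (s_mem q c d n))
    (fun a b c d m n => swap q a b c d _ _ (t_mem q a b m) (t_mem q c d n))

/-- The coproduct `Δ : U → U ⊗ U`, the morphism of (super)algebras with
`Δ(s_ij(z)) = ∑_k ε(i,j,k) s_ik(z) ⊗ s_kj(z)`, `Δ(t_ij(z)) = ∑_k ε(i,j,k) t_ik(z) ⊗ t_kj(z)`;
see `comul_s`, `comul_t`. -/
def comul (q : ℂ) : U q →ₐ[ℂ] U2 q := U.lift q _ _ (sat_comul q)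

theorem comul_s (q : ℂ) (i j : Fin 2) (n : ℕ) : comul q (s q i j n) =
    ∑ k, sgn i k k j • ∑ p ∈ Finset.HasAntidiagonal.antidiagonal n,
      GradedTensorProduct.tmul ℂ (s q i k p.1) (s q k j p.2) := by
  rw [comul, U.lift_s, comul2]
  simp only [inclL, inclR]
  refine Finset.sum_congr rfl fun k _ => congrArg _ (Finset.sum_congr rfl fun p _ => ?_)
  exact GradedTensorProduct.tmul_one_mul_one_tmul (grade q) (grade q) _ _

theorem comul_t (q : ℂ) (i j : Fin 2) (n : ℕ) : comul q (t q i j n) =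
    ∑ k, sgn i k k j • ∑ p ∈ Finset.HasAntidiagonal.antidiagonal n,
      GradedTensorProduct.tmul ℂ (t q i k p.1) (t q k j p.2) := by
  rw [comul, U.lift_t, comul2]
  refine Finset.sum_congr rfl fun k _ => congrArg _ (Finset.sum_congr rfl fun p _ => ?_)
  exact GradedTensorProduct.tmul_one_mul_one_tmul (grade q) (grade q) _ _

end coproduct

section expLog

/-- `g(x)` for a complex power series `g` and a series `x` without constant term. -/
def evalNil {A : Type*} [Ring A] [Algebra ℂ A] (g : ℂ⟦X⟧) (x : A⟦X⟧) : A⟦X⟧ :=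
  mk fun n => ∑ k ∈ Finset.range (n + 1), coeff k g • coeff n (x ^ k)

/-- `exp(x)` for a power series `x` without constant term. -/
def psExp {A : Type*} [Ring A] [Algebra ℂ A] (x : A⟦X⟧) : A⟦X⟧ := evalNil (exp ℂ) x

/-- `log(f)` for a power series `f` with constant term `1`; inverse to `psExp`. -/
def psLog {A : Type*} [Ring A] [Algebra ℂ A] (f : A⟦X⟧) : A⟦X⟧ := evalNil (log ℂ) (f - 1)

variable {A : Type*} [Ring A] [Algebra ℂ A]

theorem coeff_pow_zero {x : A⟦X⟧} (hx : constantCoeff x = 0) {k n : ℕ} (h : n < k) :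
    coeff n (x ^ k) = 0 := by
  obtain ⟨y, rfl⟩ := X_dvd_iff.2 hx
  rw [((commute_X y).symm).mul_pow, coeff_X_pow_mul', if_neg (by omega)]

theorem coeff_evalNil {x : A⟦X⟧} (hx : constantCoeff x = 0) (g : ℂ⟦X⟧) {n N : ℕ} (h : n < N) :
    coeff n (evalNil g x) = ∑ k ∈ Finset.range N, coeff k g • coeff n (x ^ k) := by
  rw [evalNil, coeff_mk]
  refine Finset.sum_subset (by intro i; simp; omega) ?_
  intro k _ hk
  rw [coeff_pow_zero hx (by simpa using hk), smul_zero]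

theorem coeff_evalNil_poly {x : A⟦X⟧} (hx : constantCoeff x = 0) (g : ℂ⟦X⟧) (p : Polynomial ℂ)
    (n : ℕ) (h : ∀ k ≤ n, p.coeff k = coeff k g) :
    coeff n (evalNil g x) = coeff n (Polynomial.aeval x p) := by
  rw [Polynomial.aeval_eq_sum_range' (n := max (n + 1) (p.natDegree + 1)) (by omega), map_sum,
    coeff_evalNil hx g (N := max (n + 1) (p.natDegree + 1)) (by omega)]
  refine Finset.sum_congr rfl fun k _ => ?_
  by_cases hk : k ≤ n
  · rw [h k hk, PowerSeries.coeff_smul]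
  · rw [PowerSeries.coeff_smul, coeff_pow_zero hx (by omega), smul_zero, smul_zero]

theorem evalNil_mul {x : A⟦X⟧} (hx : constantCoeff x = 0) (g₁ g₂ : ℂ⟦X⟧) :
    evalNil (g₁ * g₂) x = evalNil g₁ x * evalNil g₂ x := by
  ext n
  have ht : ∀ g : ℂ⟦X⟧, ∀ k ≤ n, (trunc (n + 1) g).coeff k = coeff k g := fun g k hk => by
    rw [coeff_trunc, if_pos (by omega)]
  rw [coeff_evalNil_poly hx (g₁ * g₂) (trunc (n + 1) g₁ * trunc (n + 1) g₂) n, map_mul, coeff_mul,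
    coeff_mul]
  · refine Finset.sum_congr rfl fun p hp => ?_
    have := Finset.HasAntidiagonal.mem_antidiagonal.1 hp
    rw [coeff_evalNil_poly hx g₁ _ p.1 fun k hk => ht g₁ k (by omega),
      coeff_evalNil_poly hx g₂ _ p.2 fun k hk => ht g₂ k (by omega)]
  · intro k hk
    rw [Polynomial.coeff_mul, coeff_mul]
    refine Finset.sum_congr rfl fun p hp => ?_
    have := Finset.HasAntidiagonal.mem_antidiagonal.1 hp
    rw [ht _ _ (by omega), ht _ _ (by omega)]

theorem evalNil_one (x : A⟦X⟧) : evalNil 1 x = 1 := by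
  ext n
  rw [evalNil, coeff_mk, Finset.sum_eq_single 0]
  · simp
  · intro k _ hk; simp [coeff_one, hk]
  · simp

theorem evalNil_pow {x : A⟦X⟧} (hx : constantCoeff x = 0) (g : ℂ⟦X⟧) (k : ℕ) :
    evalNil (g ^ k) x = evalNil g x ^ k := by
  induction k with
  | zero => simp [evalNil_one]
  | succ k ih => rw [pow_succ, pow_succ, evalNil_mul hx, ih]

theorem subst_eq_evalNil {x : ℂ⟦X⟧} (hx : constantCoeff x = 0) (g : ℂ⟦X⟧) :
    g.subst x = evalNil g x := by
  ext n
  rw [coeff_subst' (HasSubst.of_constantCoeff_zero' hx), evalNil, coeff_mk]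
  refine finsum_eq_sum_of_support_subset _ ?_
  intro k hk
  by_contra h
  refine hk ?_
  have : n < k := by simpa using h
  simp only [coeff_pow_zero hx this, smul_zero]

theorem evalNil_exp_log : evalNil (exp ℂ) (log ℂ) = 1 + (X : ℂ⟦X⟧) := by
  have hs : HasSubst (log ℂ) := HasSubst.log
  rw [← subst_eq_evalNil constantCoeff_log]
  set f := (exp ℂ).subst (log ℂ) with hf
  have h0 : coeff 0 f = 1 := by
    rw [hf, subst_eq_evalNil constantCoeff_log, evalNil, coeff_mk]
    simp
  have hg : (d⁄dX ℂ (log ℂ)) * (1 + X) = 1 := by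
    rw [deriv_log]
    ext n
    rw [mul_add, mul_one, map_add]
    rcases n with _ | n
    · simp
    · rw [coeff_succ_mul_X, coeff_mk, coeff_mk, coeff_one, if_neg (by omega), pow_succ]
      simp
  have hd : d⁄dX ℂ f * (1 + X) = f := by
    rw [hf, derivative_subst hs, derivative_exp, mul_assoc, hg, mul_one]
  have hstep : ∀ n : ℕ, coeff (n + 1) f * (n + 1) + n * coeff n f = coeff n f := by
    intro n
    have := congrArg (coeff n) hd
    rw [mul_add, mul_one, map_add, coeff_derivative] at this
    rcases n with _ | n
    · simpa using this
    · rw [coeff_succ_mul_X, coeff_derivative] at this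
      push_cast at this ⊢
      rw [mul_comm _ (coeff (n + 1) f)]
      exact this
  have h1 : coeff 1 f = 1 := by simpa [h0] using hstep 0
  have h2 : ∀ n, coeff (n + 2) f = 0 := by
    intro n
    induction n with
    | zero =>
      have := hstep 1
      rw [h1] at this
      norm_num at this
      exact this
    | succ n ih =>
      have := hstep (n + 2)
      rw [ih, mul_zero, add_zero] at this
      rcases mul_eq_zero.1 this with h | h
      · exact h
      · exact absurd h (by exact_mod_cast Nat.succ_ne_zero (n + 2))
  ext n
  match n with
  | 0 => rw [h0]; simp
  | 1 => rw [h1]; simp [coeff_one]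
  | n + 2 => rw [h2]; simp [coeff_one, coeff_X]

theorem psExp_psLog {f : A⟦X⟧} (hf : constantCoeff f = 1) : psExp (psLog f) = f := by
  have hx : constantCoeff (f - 1) = 0 := by simp [hf]
  have h1 : psExp (psLog f) = evalNil (evalNil (exp ℂ) (log ℂ)) (f - 1) := by
    ext n
    have a1 : ∀ {B : Type _} [Ring B] [Algebra ℂ B] (g : ℂ⟦X⟧) (y : B⟦X⟧), coeff n (evalNil g y) =
        ∑ k ∈ Finset.range (n + 1), coeff k g • coeff n (y ^ k) := fun _ _ => coeff_mk _ _
    rw [psExp, a1, psLog, a1]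
    simp only [← evalNil_pow hx]
    have e1 : ∀ k, coeff n (evalNil (log ℂ ^ k) (f - 1)) =
        ∑ j ∈ Finset.range (n + 1), coeff j (log ℂ ^ k) • coeff n ((f - 1) ^ j) :=
      fun k => coeff_evalNil hx _ (Nat.lt_succ_self n)
    have e2 : ∀ j ∈ Finset.range (n + 1),
        coeff j (evalNil (exp ℂ) (log ℂ)) • coeff n ((f - 1) ^ j) =
        ∑ k ∈ Finset.range (n + 1),
          (coeff k (exp ℂ) * coeff j (log ℂ ^ k)) • coeff n ((f - 1) ^ j) := fun j hj => by
      rw [coeff_evalNil constantCoeff_log _ (Finset.mem_range.1 hj), Finset.sum_smul]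
      rfl
    rw [Finset.sum_congr rfl e2, Finset.sum_comm]
    simp only [e1, Finset.smul_sum, smul_smul]
  rw [h1, evalNil_exp_log]
  ext n
  rw [coeff_evalNil_poly hx _ (1 + Polynomial.X) n]
  · simp
  · intro k _; simp [Polynomial.coeff_one, Polynomial.coeff_X, coeff_one, coeff_X, eq_comm]
end expLog

section drinfeld

theorem constCoeff_mk {A : Type*} [Ring A] (f : ℕ → A) : constantCoeff (mk f) = f 0 := by
  rw [← coeff_zero_eq_constantCoeff_apply, coeff_mk]

section gauss
variable {A : Type*} [Ring A] [Algebra ℂ A]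

/-- The product of matrices over `A⟦z⟧`, with `x` standing for `∑ x_ij ⊗ E_ij` in the tensor product
of superalgebras with `End V`: the `(i,j)` entry is `∑_k (-1)^{(|i|+|k|)(|k|+|j|)} x_ik y_kj`. -/
def superMul (x y : Matrix (Fin 2) (Fin 2) A⟦X⟧) : Matrix (Fin 2) (Fin 2) A⟦X⟧ :=
  fun i j => ∑ k, sgn i k k j • (x i k * y k j)

/-! The factors of the Gauss decomposition of `x`, when `x_11` has the invertible constant term `u`. -/

/-- The entry `E` of the upper triangular factor. -/
def gaussE (x : Matrix (Fin 2) (Fin 2) A⟦X⟧) (u : Aˣ) : A⟦X⟧ := invOfUnit (x 0 0) u * x 0 1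

/-- The entry `F` of the lower triangular factor. -/
def gaussF (x : Matrix (Fin 2) (Fin 2) A⟦X⟧) (u : Aˣ) : A⟦X⟧ := x 1 0 * invOfUnit (x 0 0) u

/-- The first diagonal entry. -/
def gaussK₁ (x : Matrix (Fin 2) (Fin 2) A⟦X⟧) : A⟦X⟧ := x 0 0

/-- The second diagonal entry (with a plus sign, because matrices are multiplied by `superMul`). -/
def gaussK₂ (x : Matrix (Fin 2) (Fin 2) A⟦X⟧) (u : Aˣ) : A⟦X⟧ :=
  x 1 1 + x 1 0 * invOfUnit (x 0 0) u * x 0 1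

theorem gauss_decomposition (x : Matrix (Fin 2) (Fin 2) A⟦X⟧) (u : Aˣ)
    (hu : constantCoeff (x 0 0) = u) :
    superMul (superMul !![1, 0; gaussF x u, 1] !![gaussK₁ x, 0; 0, gaussK₂ x u])
      !![1, gaussE x u; 0, 1] = x := by
  have h1 : x 0 0 * invOfUnit (x 0 0) u = 1 := mul_invOfUnit _ _ hu
  have h2 : invOfUnit (x 0 0) u * x 0 0 = 1 := invOfUnit_mul _ _ hu
  ext i j : 2
  fin_cases i <;> fin_cases j
  · simp [superMul, sgn, gaussK₁]
  · simp [superMul, sgn, gaussK₁, gaussE, ← mul_assoc, h1]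
  · simp [superMul, sgn, gaussK₁, gaussF, mul_assoc, h2]
  · simp only [superMul, sgn, gaussK₁, gaussF, gaussK₂, gaussE, Fin.sum_univ_two]
    simp
    rw [mul_assoc (x 1 0), h2, mul_one, mul_assoc]
    norm_num
end gauss

variable (q : ℂ)

/-- `S(z)`, with entries in `U⟦z⟧`. -/
def Smat : Matrix (Fin 2) (Fin 2) (U q)⟦X⟧ := fun i j => mk (s q i j)

/-- `T(z)`; the variable of the power series stands for `z⁻¹`. -/
def Tmat : Matrix (Fin 2) (Fin 2) (U q)⟦X⟧ := fun i j => mk (t q i j)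

/-- `s_ii^(0)` as a unit, with inverse `t_ii^(0)`. -/
def unitS (i : Fin 2) : (U q)ˣ := ⟨s q i i 0, t q i i 0, (U.sat q).s_mul_t i, (U.sat q).t_mul_s i⟩

/-- `E^+(z)`, from the Gauss decomposition of `S(z)`, a series in `z`. -/
def Eplus : (U q)⟦X⟧ := gaussE (Smat q) (unitS q 0)

/-- `F^+(z)`, from the Gauss decomposition of `S(z)`, a series in `z`. -/
def Fplus : (U q)⟦X⟧ := gaussF (Smat q) (unitS q 0)

/-- `K_1^+(z)`, from the Gauss decomposition of `S(z)`, a series in `z`. -/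
def K₁plus : (U q)⟦X⟧ := gaussK₁ (Smat q)

/-- `K_2^+(z)`, from the Gauss decomposition of `S(z)`, a series in `z`. -/
def K₂plus : (U q)⟦X⟧ := gaussK₂ (Smat q) (unitS q 0)

/-- `φ^+(z) = K_1^+(z)⁻¹ K_2^+(z)`, a series in `z`. -/
def phiPlus : (U q)⟦X⟧ := invOfUnit (K₁plus q) (unitS q 0) * K₂plus q

/-- `E^-(z)`, from the Gauss decomposition of `T(z)`, a series in `z⁻¹`. -/
def Eminus : (U q)⟦X⟧ := gaussE (Tmat q) (unitS q 0)⁻¹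

/-- `F^-(z)`, from the Gauss decomposition of `T(z)`, a series in `z⁻¹`. -/
def Fminus : (U q)⟦X⟧ := gaussF (Tmat q) (unitS q 0)⁻¹

/-- `K_1^-(z)`, from the Gauss decomposition of `T(z)`, a series in `z⁻¹`. -/
def K₁minus : (U q)⟦X⟧ := gaussK₁ (Tmat q)

/-- `K_2^-(z)`, from the Gauss decomposition of `T(z)`, a series in `z⁻¹`. -/
def K₂minus : (U q)⟦X⟧ := gaussK₂ (Tmat q) (unitS q 0)⁻¹

/-- `φ^-(z) = K_1^-(z)⁻¹ K_2^-(z)`, a series in `z⁻¹`. -/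
def phiMinus : (U q)⟦X⟧ := invOfUnit (K₁minus q) (unitS q 0)⁻¹ * K₂minus q

theorem gauss_plus : superMul (superMul !![1, 0; Fplus q, 1] !![K₁plus q, 0; 0, K₂plus q])
    !![1, Eplus q; 0, 1] = Smat q :=
  gauss_decomposition _ _ (by simp [Smat, unitS, constCoeff_mk])

theorem gauss_minus : superMul (superMul !![1, 0; Fminus q, 1] !![K₁minus q, 0; 0, K₂minus q])
    !![1, Eminus q; 0, 1] = Tmat q :=
  gauss_decomposition _ _ (by simp [Tmat, unitS, constCoeff_mk])

/-- `E_n`, defined by `E^+(z) = ∑_{n ≥ 0} E_n z^n`, `E^-(z) = -∑_{n ≤ -1} E_n z^n`. -/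
def E (n : ℤ) : U q := if 0 ≤ n then coeff n.toNat (Eplus q) else -coeff (-n).toNat (Eminus q)

/-- `F_n`, defined by `F^+(z) = -∑_{n ≥ 1} F_n z^n`, `F^-(z) = ∑_{n ≤ 0} F_n z^n`. -/
def F (n : ℤ) : U q := if 0 < n then -coeff n.toNat (Fplus q) else coeff (-n).toNat (Fminus q)

/-- `(s_11^(0))⁻¹ s_22^(0)`. -/
def phiZero : (U q)ˣ := (unitS q 0)⁻¹ * unitS q 1

/-- `h_r` (`r ≠ 0`), defined by `K_1^±(z) = (s_11^(0))^{±1} exp(±(q-q⁻¹) ∑_{r>0} h_{±r} z^{±r})`;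
see `K₁plus_eq`, `K₁minus_eq`. -/
def h (r : ℤ) : U q :=
  if 0 < r then (q - q⁻¹)⁻¹ • coeff r.toNat (psLog (C (↑(unitS q 0)⁻¹ : U q) * K₁plus q))
  else -(q - q⁻¹)⁻¹ • coeff (-r).toNat (psLog (C (unitS q 0 : U q) * K₁minus q))

/-- `C_r` (`r ≠ 0`), defined by
`φ^±(z) = ((s_11^(0))⁻¹ s_22^(0))^{±1} exp(±(q-q⁻¹) ∑_{r>0} C_{±r} z^{±r})`;
see `phiPlus_eq`, `phiMinus_eq`. -/
def c (r : ℤ) : U q :=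
  if 0 < r then (q - q⁻¹)⁻¹ • coeff r.toNat (psLog (C (↑(phiZero q)⁻¹ : U q) * phiPlus q))
  else -(q - q⁻¹)⁻¹ • coeff (-r).toNat (psLog (C (phiZero q : U q) * phiMinus q))

theorem Eplus_eq : Eplus q = mk fun n => E q n := by
  ext n; simp [E]

theorem Eminus_eq : Eminus q = -mk fun n => if n = 0 then 0 else E q (-n) := by
  ext n
  rcases n with _ | n
  · have : t q 0 1 0 = 0 := (U.sat q).t12
    simp [Eminus, gaussE, Tmat, this, constCoeff_mk]
  · simp [E, -neg_add_rev]

theorem Fplus_eq : Fplus q = -mk fun n => if n = 0 then 0 else F q n := by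
  ext n
  rcases n with _ | n
  · have : s q 1 0 0 = 0 := (U.sat q).s21
    simp [Fplus, gaussF, Smat, this, constCoeff_mk]
  · simp [F]

theorem Fminus_eq : Fminus q = mk fun n => F q (-n) := by
  ext n; simp [F]

theorem psExp_of_log {u : (U q)ˣ} (f : (U q)⟦X⟧) (d : ℂ) (hd : d ≠ 0) (y : ℕ → U q)
    (hf : constantCoeff f = u) 
    (hy : ∀ n, n ≠ 0 → y n = d⁻¹ • coeff n (psLog (C (↑u⁻¹ : U q) * f))) :
    f = C (u : U q) * psExp (d • mk fun n => if n = 0 then 0 else y n) := by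
  have h1 : constantCoeff (C (↑u⁻¹ : U q) * f) = 1 := by simp [hf]
  have : (d • mk fun n => if n = 0 then 0 else y n) = psLog (C (↑u⁻¹ : U q) * f) := by
    ext n
    rw [PowerSeries.coeff_smul, coeff_mk]
    split_ifs with h
    · subst h; simp [psLog, evalNil, h1]
    · rw [hy n h, smul_smul, mul_inv_cancel₀ hd, one_smul]
  rw [this, psExp_psLog h1, ← mul_assoc, ← map_mul]
  simp

theorem K₁plus_eq (hq : q - q⁻¹ ≠ 0) :
    K₁plus q = C (unitS q 0 : U q) *
      psExp ((q - q⁻¹) • mk fun n => if n = 0 then 0 else h q n) := by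
  refine psExp_of_log q _ _ hq (fun n => h q n) ?_ ?_
  · simp [K₁plus, gaussK₁, Smat, unitS, constCoeff_mk]
  · intro n hn; simp [h, Nat.pos_of_ne_zero hn]

theorem K₁minus_eq (hq : q - q⁻¹ ≠ 0) :
    K₁minus q = C (↑(unitS q 0)⁻¹ : U q) *
      psExp (-(q - q⁻¹) • mk fun n => if n = 0 then 0 else h q (-n)) := by
  refine psExp_of_log q _ _ (neg_ne_zero.2 hq) (fun n => h q (-n)) ?_ ?_
  · simp [K₁minus, gaussK₁, Tmat, unitS, constCoeff_mk]
  · intro n hn; simp [h, neg_inv]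

theorem unitS_comm : s q 0 0 0 * s q 1 1 0 = s q 1 1 0 * s q 0 0 0 := by
  have := (U.sat q).ss 1 0 0 0 1 1
  have h0 : s q 1 0 0 = 0 := (U.sat q).s21
  simpa [rttL, rttR, Fin.sum_univ_two, upModes, Rz, Rw, sgn, h0] using this

theorem phiPlus_eq (hq : q - q⁻¹ ≠ 0) :
    phiPlus q = C (phiZero q : U q) *
      psExp ((q - q⁻¹) • mk fun n => if n = 0 then 0 else c q n) := by
  refine psExp_of_log q _ _ hq (fun n => c q n) ?_ ?_
  · have h0 : s q 1 0 0 = 0 := (U.sat q).s21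
    simp [phiPlus, K₂plus, gaussK₂, Smat, phiZero, unitS, constCoeff_mk, h0]
  · intro n hn; simp [c, Nat.pos_of_ne_zero hn]

theorem phiMinus_eq (hq : q - q⁻¹ ≠ 0) :
    phiMinus q = C (↑(phiZero q)⁻¹ : U q) *
      psExp (-(q - q⁻¹) • mk fun n => if n = 0 then 0 else c q (-n)) := by
  refine psExp_of_log q _ _ (neg_ne_zero.2 hq) (fun n => c q (-n)) ?_ ?_
  · have h0 : t q 0 1 0 = 0 := (U.sat q).t12
    simp [phiMinus, K₂minus, gaussK₂, Tmat, phiZero, unitS, constCoeff_mk, h0]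
    have e1 := (U.sat q).t_mul_s 1
    have e2 := (U.sat q).s_mul_t 1
    calc s q 0 0 0 * t q 1 1 0
        = t q 1 1 0 * (s q 1 1 0 * s q 0 0 0) * t q 1 1 0 := by
          rw [← mul_assoc, e1, one_mul]
      _ = t q 1 1 0 * s q 0 0 0 := by
          rw [← unitS_comm, mul_assoc, mul_assoc, e2, mul_one]
  · intro n hn; simp [c, neg_inv]


/-- `f(z) ⊗ g(z)` for series `f`, `g` in the same variable. -/
def tens (f g : (U q)⟦X⟧) : (U2 q)⟦X⟧ :=
  mk fun n => ∑ p ∈ Finset.HasAntidiagonal.antidiagonal n, coeff p.1 f ᵍ⊗ₜ[ℂ] coeff p.2 g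

/-- `Δ` applied to the coefficients of a series. -/
def comulSer (f : (U q)⟦X⟧) : (U2 q)⟦X⟧ := mk fun n => comul q (coeff n f)

/-- The `q`-integer `[r]`. -/
def qInt (r : ℤ) : ℂ := (q ^ r - q ^ (-r)) / (q - q⁻¹)

end drinfeld

end

end QAffGL

/-!
For either sign write `S(z)` or `T(z)` as a matrix `x(z)` with rows `(A, B)` and `(C, D)`, so that
`E = A⁻¹ B`, `F = C A⁻¹`, `K_1 = A`, `K_2 = D + C A⁻¹ B` and `φ = A⁻¹ K_2`.  The coproduct of the
matrix entries reads `Δ(A) = A ⊗ A - B ⊗ C`, and so on.  Multiplying out in the tensor product of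
superalgebras, the formulas for `Δ(E)`, `Δ(F)` and `Δ(φ)` reduce to four identities between series
in the *same* variable: `E² = 0`, `F² = 0`, `A K_2 = K_2 A` and `B φ = D E`
(`RTTSeries.gaussE_mul_self`, `RTTSeries.gaussF_mul_self`, `RTTSeries.commute_gaussK₂`,
`RTTSeries.mul_gaussPhi_eq`).  Since `φ` is even, `φ ⊗ 1` and `1 ⊗ φ` commute, so the logarithm of
the grouplike series `φ` is primitive (`psLog_mul`, `serΔ_psLog_of_grouplike`), which is the
statement on `C_s`.

These identities come from the RTT relation in two variables by restriction to lines
(`DiagonalRTT`).  On `w = z` much of the relation is empty, but its derivative under `w d/dw` is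
not.
On `w = l z` with `l = q^{±2}` the coefficient of `E_11 ⊗ E_11` in the `R`-matrix vanishes, which
gives `A E(z) = q E(l z) A` and `F(z) A = q⁻¹ A F(l z)`.

For `h_s`, the last relation yields `Δ(A) = (A ⊗ A)(1 - e)` with `e = q⁻¹ E(z) ⊗ F(l z)`.  As `A`
commutes with its derivative, so does `Δ(A)`, and the logarithm of `Δ(A)` may be computed through
its logarithmic derivative, without a Baker-Campbell-Hausdorff series.  With `a = A⁻¹ (z d/dz) A`
and because `e` is nilpotent in the required sense, the result is
`a ⊗ 1 + 1 ⊗ a + [e, a ⊗ 1 + 1 ⊗ a] - (z d/dz) e`.  The brackets of `a` with `E(z)` and `F(l z)`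
(`RTTSeries.gaussE_bracket`, `RTTSeries.gaussF_bracket`) turn the correction into a multiple of
`E(l z) ⊗ F(l z) - E(z) ⊗ F(z)` (`RTTCoproduct.euler_serΔ_psLog`), whose coefficients are the sums
`∑ E_i ⊗ F_{s-i}` times `q^{±2s} - 1`.

Both signs are treated at once: `RTTCoproduct` collects what is used of `x(z)`, and the parameter
`ε = ±1` records whether the variable is `z` or `z⁻¹`.
-/

open scoped TensorProduct PowerSeries GradedTensorProduct

namespace QAffGL

noncomputable section

set_option linter.unusedSimpArgs false

open PowerSeries

/-! ### Logarithm and exponential of noncommutative power series -/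

section expLogLemmas

variable {A : Type*} [Ring A] [Algebra ℂ A]

theorem constantCoeff_evalNil {g : ℂ⟦X⟧} (hg : constantCoeff g = 0) (x : A⟦X⟧) :
    constantCoeff (evalNil g x) = 0 := by
  rw [← coeff_zero_eq_constantCoeff_apply, evalNil, coeff_mk]
  simp [hg]

theorem evalNil_evalNil {x : A⟦X⟧} (hx : constantCoeff x = 0) (g : ℂ⟦X⟧) {l : ℂ⟦X⟧}
    (hl : constantCoeff l = 0) : evalNil g (evalNil l x) = evalNil (evalNil g l) x := by
  ext n
  have hN := Nat.lt_succ_self n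
  rw [coeff_evalNil (constantCoeff_evalNil hl x) g hN, coeff_evalNil hx _ hN]
  have e2 : ∀ j ∈ Finset.range (n + 1), coeff j (evalNil g l) • coeff n (x ^ j) =
      ∑ k ∈ Finset.range (n + 1), (coeff k g * coeff j (l ^ k)) • coeff n (x ^ j) := fun j hj => by
    rw [coeff_evalNil hl _ (Finset.mem_range.1 hj), Finset.sum_smul]
    rfl
  rw [Finset.sum_congr rfl e2, Finset.sum_comm]
  refine Finset.sum_congr rfl fun k _ => ?_
  rw [← evalNil_pow hx, coeff_evalNil hx _ hN, Finset.smul_sum]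
  simp only [smul_smul]

/-- Coefficientwise, a product of values of power series agrees with a product of values of
polynomials; so identities between polynomials in `x` and `y` carry over. -/
theorem coeff_evalNil_mul_evalNil {x y : A⟦X⟧} (hx : constantCoeff x = 0)
    (hy : constantCoeff y = 0) (g₁ g₂ : ℂ⟦X⟧) (n : ℕ) :
    coeff n (evalNil g₁ x * evalNil g₂ y) =
      coeff n (Polynomial.aeval x (trunc (n + 1) g₁) * Polynomial.aeval y (trunc (n + 1) g₂)) := by
  have ht : ∀ g : ℂ⟦X⟧, ∀ k ≤ n, (trunc (n + 1) g).coeff k = coeff k g := fun g k hk => by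
    rw [coeff_trunc, if_pos (by omega)]
  rw [coeff_mul, coeff_mul]
  refine Finset.sum_congr rfl fun p hp => ?_
  have := Finset.HasAntidiagonal.mem_antidiagonal.1 hp
  rw [coeff_evalNil_poly hx g₁ _ p.1 fun k hk => ht g₁ k (by omega),
    coeff_evalNil_poly hy g₂ _ p.2 fun k hk => ht g₂ k (by omega)]

/-- Commutation of `x` and `y` as series suffices; their coefficients need not commute. -/
theorem commute_evalNil {x y : A⟦X⟧} (h : Commute x y) (hx : constantCoeff x = 0)
    (hy : constantCoeff y = 0) (g₁ g₂ : ℂ⟦X⟧) :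
    Commute (evalNil g₁ x) (evalNil g₂ y) := by
  ext n
  rw [coeff_evalNil_mul_evalNil hx hy, coeff_evalNil_mul_evalNil hy hx]
  congr 1
  rw [Polynomial.aeval_eq_sum_range, Polynomial.aeval_eq_sum_range]
  refine Commute.sum_left _ _ _ fun i _ => Commute.sum_right _ _ _ fun j _ => ?_
  exact ((h.pow_pow i j).smul_left _).smul_right _

theorem coeff_pow_mul_pow {x y : A⟦X⟧} (hx : constantCoeff x = 0) (hy : constantCoeff y = 0)
    {i j n : ℕ} (h : n < i + j) : coeff n (x ^ i * y ^ j) = 0 := by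
  rw [coeff_mul]
  refine Finset.sum_eq_zero fun p hp => ?_
  have := Finset.HasAntidiagonal.mem_antidiagonal.1 hp
  rcases lt_or_ge p.1 i with h1 | h1
  · rw [coeff_pow_zero hx h1, zero_mul]
  · rw [coeff_pow_zero hy (k := j) (n := p.2) (by omega), mul_zero]

theorem psExp_add {x y : A⟦X⟧} (h : Commute x y) (hx : constantCoeff x = 0)
    (hy : constantCoeff y = 0) : psExp (x + y) = psExp x * psExp y := by
  ext n
  have hxy : constantCoeff (x + y) = 0 := by rw [map_add, hx, hy, add_zero]
  have hN := Nat.lt_succ_self n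
  have e : ∀ (z : A⟦X⟧) (m : ℕ), m ≤ n → constantCoeff z = 0 → coeff m (psExp z) =
      ∑ k ∈ Finset.range (n + 1), (coeff k (exp ℂ)) • coeff m (z ^ k) := fun z m hm hz =>
    coeff_evalNil hz _ (by omega)
  have hR : coeff n (psExp x * psExp y) = ∑ i ∈ Finset.range (n + 1), ∑ j ∈ Finset.range (n + 1),
      (coeff i (exp ℂ) * coeff j (exp ℂ)) • coeff n (x ^ i * y ^ j) := by
    simp only [coeff_mul, Finset.smul_sum]
    rw [Finset.sum_congr rfl fun i _ => Finset.sum_comm, Finset.sum_comm]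
    refine Finset.sum_congr rfl fun p hp => ?_
    have := Finset.HasAntidiagonal.mem_antidiagonal.1 hp
    rw [e x p.1 (by omega) hx, e y p.2 (by omega) hy, Finset.sum_mul_sum]
    simp only [smul_mul_smul_comm]
  have hL : coeff n (psExp (x + y)) = ∑ k ∈ Finset.range (n + 1),
      ∑ p ∈ Finset.HasAntidiagonal.antidiagonal k,
        (coeff p.1 (exp ℂ) * coeff p.2 (exp ℂ)) • coeff n (x ^ p.1 * y ^ p.2) := by
    rw [e _ n le_rfl hxy]
    refine Finset.sum_congr rfl fun k _ => ?_
    rw [h.add_pow', map_sum, Finset.smul_sum]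
    refine Finset.sum_congr rfl fun p hp => ?_
    have hp := Finset.HasAntidiagonal.mem_antidiagonal.1 hp
    rw [map_nsmul, ← Nat.cast_smul_eq_nsmul ℂ, smul_smul]
    congr 1
    subst hp
    rw [Nat.choose_symm_add, Nat.add_choose]
    simp only [coeff_exp]
    rw [Nat.cast_div (Nat.factorial_mul_factorial_dvd_factorial_add _ _)
      (by exact_mod_cast (Nat.mul_pos (Nat.factorial_pos _) (Nat.factorial_pos _)).ne')]
    have h1 : ((p.1 + p.2).factorial : ℂ) ≠ 0 := by exact_mod_cast (Nat.factorial_pos _).ne'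
    push_cast
    simp
    field_simp
  rw [hL, hR, Finset.sum_sigma', ← Finset.sum_product']
  -- the pairs with `i + j > n` contribute zero
  refine Finset.sum_bij_ne_zero (fun a _ _ => a.2) ?_ ?_ ?_ ?_
  · rintro ⟨k, p⟩ h1 h2
    simp only [Finset.mem_sigma, Finset.mem_range, Finset.HasAntidiagonal.mem_antidiagonal] at h1
    simp only [Finset.mem_product, Finset.mem_range]
    omega
  · rintro ⟨k, p⟩ h1 - ⟨k', p'⟩ h1' - h
    simp only [Finset.mem_sigma, Finset.HasAntidiagonal.mem_antidiagonal] at h1 h1' h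
    obtain ⟨-, rfl⟩ := h1
    obtain ⟨-, rfl⟩ := h1'
    subst h
    rfl
  · rintro ⟨i, j⟩ _ h2
    refine ⟨⟨i + j, i, j⟩, ?_, h2, rfl⟩
    have : ¬ n < i + j := fun h => h2 (by rw [coeff_pow_mul_pow hx hy h, smul_zero])
    simp only [Finset.mem_sigma, Finset.mem_range, Finset.HasAntidiagonal.mem_antidiagonal]
    exact ⟨by omega, trivial⟩
  · rintro ⟨k, p⟩ _ _
    rfl

theorem deriv_log_mul : d⁄dX ℂ (log ℂ) * (1 + X) = 1 := by
  rw [deriv_log]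
  ext n
  rw [mul_add, mul_one, map_add]
  rcases n with _ | n
  · simp
  · rw [coeff_succ_mul_X, coeff_mk, coeff_mk, coeff_one, if_neg (by omega), pow_succ]
    simp

theorem evalNil_log_exp : evalNil (log ℂ) (exp ℂ - 1) = (X : ℂ⟦X⟧) := by
  have h0 : constantCoeff (exp ℂ - 1) = 0 := by simp
  have hs : HasSubst (exp ℂ - 1) := HasSubst.exp_sub_one
  rw [← subst_eq_evalNil h0]
  refine derivative.ext ?_ ?_
  · have h1 : (d⁄dX ℂ (log ℂ)).subst (exp ℂ - 1) * exp ℂ = 1 := by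
      have := congrArg (fun f : ℂ⟦X⟧ => f.subst (exp ℂ - 1)) deriv_log_mul
      simp only [subst_mul hs, subst_add hs, subst_X hs] at this
      have one : (1 : ℂ⟦X⟧).subst (exp ℂ - 1) = (1 : ℂ⟦X⟧) := by
        rw [← coe_substAlgHom hs, map_one]
      rwa [one, add_sub_cancel] at this
    rw [derivative_subst hs, map_sub, derivative_exp, derivative_X]
    simpa using h1
  · rw [subst_eq_evalNil h0, constantCoeff_evalNil constantCoeff_log]
    simp

theorem psExp_sub_one (x : A⟦X⟧) : psExp x - 1 = evalNil (exp ℂ - 1) x := by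
  ext n
  simp only [psExp, evalNil, map_sub, coeff_mk, sub_smul, Finset.sum_sub_distrib]
  congr 1
  rw [Finset.sum_eq_single 0]
  · simp
  · intro k _ hk; simp [coeff_one, hk]
  · simp

theorem psLog_psExp {x : A⟦X⟧} (hx : constantCoeff x = 0) : psLog (psExp x) = x := by
  rw [psLog, psExp_sub_one, evalNil_evalNil hx _ (by simp), evalNil_log_exp]
  ext n
  rw [coeff_evalNil_poly hx _ Polynomial.X n]
  · simp
  · intro k _; simp [Polynomial.coeff_X, coeff_X, eq_comm]

theorem psLog_mul {f g : A⟦X⟧} (h : Commute f g) (hf : constantCoeff f = 1)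
    (hg : constantCoeff g = 1) : psLog (f * g) = psLog f + psLog g := by
  have hf' : constantCoeff (f - 1) = 0 := by simp [hf]
  have hg' : constantCoeff (g - 1) = 0 := by simp [hg]
  have h1 : constantCoeff (psLog f) = 0 := constantCoeff_evalNil constantCoeff_log _
  have h2 : constantCoeff (psLog g) = 0 := constantCoeff_evalNil constantCoeff_log _
  have hc : Commute (psLog f) (psLog g) :=
    commute_evalNil ((h.sub_left (Commute.one_left _)).sub_right
      ((Commute.one_right f).sub_left (Commute.one_right 1))) hf' hg' _ _
  rw [← psLog_psExp (x := psLog f + psLog g) (by rw [map_add, h1, h2, add_zero]),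
    psExp_add hc h1 h2, psExp_psLog hf, psExp_psLog hg]

theorem map_psLog {B : Type*} [Ring B] [Algebra ℂ B] (f : A →ₐ[ℂ] B) (x : A⟦X⟧) :
    mapAlgHom f (psLog x) = psLog (mapAlgHom f x) := by
  ext n
  rw [mapAlgHom_apply, coeff_map, psLog, psLog, evalNil, evalNil, coeff_mk, coeff_mk, map_sum]
  refine Finset.sum_congr rfl fun k _ => ?_
  have : (mapAlgHom f x - 1) ^ k = PowerSeries.map (f : A →+* B) ((x - 1) ^ k) := by
    rw [map_pow, map_sub, map_one, mapAlgHom_apply]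
  rw [this, coeff_map]
  exact map_smul f _ _

/-- The Euler derivation `z d/dz`. -/
def euler : A⟦X⟧ →ₗ[ℂ] A⟦X⟧ where
  toFun f := mk fun n => (n : ℂ) • coeff n f
  map_add' f g := by ext n; simp
  map_smul' c f := by ext n; simp [smul_comm c]

@[simp]
theorem coeff_euler (f : A⟦X⟧) (n : ℕ) : coeff n (euler f) = (n : ℂ) • coeff n f := by
  simp [euler]

theorem euler_mul (f g : A⟦X⟧) : euler (f * g) = euler f * g + f * euler g := by
  ext n
  simp only [coeff_euler, map_add, coeff_mul, Finset.smul_sum, ← Finset.sum_add_distrib]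
  refine Finset.sum_congr rfl fun p hp => ?_
  rw [← Finset.HasAntidiagonal.mem_antidiagonal.1 hp, smul_mul_assoc, mul_smul_comm, ← add_smul]
  push_cast
  rfl

theorem euler_C (a : A) : euler (C a) = 0 := by
  ext n
  rcases n with _ | n <;> simp [coeff_C]

theorem euler_one : euler (1 : A⟦X⟧) = 0 := by
  rw [← map_one C, euler_C]

theorem euler_mapAlgHom {B : Type*} [Ring B] [Algebra ℂ B] (f : A →ₐ[ℂ] B) (x : A⟦X⟧) :
    euler (mapAlgHom f x) = mapAlgHom f (euler x) := by
  ext n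
  rw [coeff_euler, mapAlgHom_apply, mapAlgHom_apply, coeff_map, coeff_map, coeff_euler]
  exact (map_smul f _ _).symm

theorem euler_pow {x : A⟦X⟧} (h : Commute x (euler x)) (k : ℕ) :
    euler (x ^ (k + 1)) = ((k : ℂ) + 1) • (x ^ k * euler x) := by
  induction k with
  | zero => simp
  | succ k ih =>
    rw [pow_succ, euler_mul, ih, smul_mul_assoc, mul_assoc, ← h.eq, ← mul_assoc, ← pow_succ]
    push_cast
    module

theorem euler_evalNil {x : A⟦X⟧} (hx : constantCoeff x = 0) (h : Commute x (euler x)) (g : ℂ⟦X⟧) :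
    euler (evalNil g x) = evalNil (d⁄dX ℂ g) x * euler x := by
  ext n
  have hL : coeff n (euler (evalNil g x)) =
      ∑ k ∈ Finset.range (n + 2), coeff k g • coeff n (euler (x ^ k)) := by
    rw [coeff_euler, coeff_evalNil hx g (N := n + 2) (by omega), Finset.smul_sum]
    refine Finset.sum_congr rfl fun k _ => ?_
    rw [coeff_euler, smul_comm]
  rw [hL, Finset.sum_range_succ', pow_zero, euler_one, map_zero, smul_zero, add_zero, coeff_mul]
  have hR : ∀ p ∈ Finset.HasAntidiagonal.antidiagonal n,
      coeff p.1 (evalNil (d⁄dX ℂ g) x) * coeff p.2 (euler x) =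
      ∑ k ∈ Finset.range (n + 1),
        coeff k (d⁄dX ℂ g) • (coeff p.1 (x ^ k) * coeff p.2 (euler x)) := by
    intro p hp
    have := Finset.HasAntidiagonal.mem_antidiagonal.1 hp
    rw [coeff_evalNil hx _ (N := n + 1) (by omega), Finset.sum_mul]
    simp only [smul_mul_assoc]
  rw [Finset.sum_congr rfl hR, Finset.sum_comm]
  refine Finset.sum_congr rfl fun k _ => ?_
  rw [euler_pow h, PowerSeries.coeff_smul, smul_smul, coeff_derivative, ← Finset.smul_sum,
    ← coeff_mul]

/-- The logarithmic derivative: valid without commutativity of `A`, as soon as `f` commutes with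
its own derivative. -/
theorem mul_euler_psLog {f : A⟦X⟧} (hf : constantCoeff f = 1) (h : Commute f (euler f)) :
    f * euler (psLog f) = euler f := by
  have hx : constantCoeff (f - 1) = 0 := by simp [hf]
  have e : euler (f - 1) = euler f := by rw [map_sub, euler_one, sub_zero]
  have hf1 : evalNil (1 + X : ℂ⟦X⟧) (f - 1) = f := by
    ext n
    rw [coeff_evalNil_poly hx _ (1 + Polynomial.X) n]
    · simp
    · intro k _; simp [Polynomial.coeff_one, Polynomial.coeff_X, coeff_one, coeff_X, eq_comm]
  have hinv : f * evalNil (d⁄dX ℂ (log ℂ)) (f - 1) = 1 := by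
    conv_lhs => enter [1]; rw [← hf1]
    rw [← evalNil_mul hx, mul_comm, deriv_log_mul, evalNil_one]
  rw [psLog, euler_evalNil hx (by rw [e]; exact h.sub_left (Commute.one_left _)), e, ← mul_assoc,
    hinv, one_mul]

end expLogLemmas

/-! ### Restriction of the RTT relations to lines `w = l z` -/

theorem X_mul_left_cancel {A : Type*} [Ring A] {f g : A⟦X⟧} (h : X * f = X * g) : f = g := by
  ext n
  simpa [coeff_succ_X_mul] using congrArg (coeff (n + 1)) h

section diagonal

variable {A : Type*} [Ring A] [Algebra ℂ A]

/-- The dilation `f(z) ↦ f(l z)`. -/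
def dil (l : ℂ) : A⟦X⟧ →ₐ[ℂ] A⟦X⟧ :=
  AlgHom.ofLinearMap
    { toFun := fun f => mk fun n => l ^ n • coeff n f
      map_add' := fun f g => by ext n; simp
      map_smul' := fun c f => by ext n; simp [smul_comm c] }
    (by
      ext n
      simp only [LinearMap.coe_mk, AddHom.coe_mk, coeff_mk, coeff_one]
      split_ifs with h <;> simp [h])
    (fun f g => by
      ext n
      simp only [LinearMap.coe_mk, AddHom.coe_mk, coeff_mk, coeff_mul, Finset.smul_sum]
      refine Finset.sum_congr rfl fun p hp => ?_
      rw [smul_mul_smul_comm, ← pow_add, Finset.HasAntidiagonal.mem_antidiagonal.1 hp])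

@[simp]
theorem coeff_dil (l : ℂ) (f : A⟦X⟧) (n : ℕ) : coeff n (dil l f) = l ^ n • coeff n f :=
  coeff_mk n fun n => l ^ n • coeff n f

theorem dil_one (f : A⟦X⟧) : dil 1 f = f := by
  ext n
  rw [coeff_dil, one_pow, one_smul]

theorem dil_injective {l : ℂ} (hl : l ≠ 0) : Function.Injective (dil (A := A) l) := by
  intro f g h
  ext n
  have := congrArg (coeff n) h
  rw [coeff_dil, coeff_dil] at this
  exact smul_right_injective A (pow_ne_zero n hl) this

theorem mapAlgHom_dil {B : Type*} [Ring B] [Algebra ℂ B] (f : A →ₐ[ℂ] B) (l : ℂ) (x : A⟦X⟧) :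
    mapAlgHom f (dil l x) = dil l (mapAlgHom f x) := by
  ext n
  rw [coeff_dil, mapAlgHom_apply, mapAlgHom_apply, coeff_map, coeff_map, coeff_dil]
  exact map_smul f _ _

theorem smul_X_mul (c : ℂ) (f : A⟦X⟧) : c • (X * f) = X * (c • f) := (mul_smul_comm c X f).symm

/-- The linear map `z^m w^n ↦ g(n) z^(m+n)` from series in `z`, `w` to series in `z`.  For
`g(n) = l^n` this is the substitution `w = l z`; for `g(n) = n l^n` it is that substitution after
`w d/dw`. -/
def diag (g : ℕ → ℂ) : A⟦X⟧⟦X⟧ →ₗ[ℂ] A⟦X⟧ where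
  toFun W := mk fun N => ∑ p ∈ Finset.HasAntidiagonal.antidiagonal N,
    g p.2 • coeff p.2 (coeff p.1 W)
  map_add' V W := by ext N; simp [Finset.sum_add_distrib]
  map_smul' c W := by
    ext N
    simp only [coeff_mk, RingHom.id_apply, PowerSeries.coeff_smul, Finset.smul_sum]
    exact Finset.sum_congr rfl fun p _ => smul_comm _ _ _

theorem coeff_diag (g : ℕ → ℂ) (W : A⟦X⟧⟦X⟧) (N : ℕ) :
    coeff N (diag g W) = ∑ p ∈ Finset.HasAntidiagonal.antidiagonal N,
      g p.2 • coeff p.2 (coeff p.1 W) := by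
  simp [diag]

theorem diag_zz_mul (g : ℕ → ℂ) (W : A⟦X⟧⟦X⟧) : diag g (zz * W) = X * diag g W := by
  ext N
  rcases N with _ | N
  · simp [coeff_diag, coeff_zz_mul]
  · rw [coeff_succ_X_mul, coeff_diag, coeff_diag, Finset.Nat.sum_antidiagonal_succ]
    simp only [coeff_zz_mul, if_pos, smul_zero, zero_add, Nat.add_one_ne_zero, if_false,
      Nat.add_sub_cancel]

theorem diag_ww_mul (g : ℕ → ℂ) (W : A⟦X⟧⟦X⟧) :
    diag g (ww * W) = X * diag (fun n => g (n + 1)) W := by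
  ext N
  rcases N with _ | N
  · simp [coeff_diag, coeff_ww_mul]
  · rw [coeff_succ_X_mul, coeff_diag, coeff_diag, Finset.Nat.sum_antidiagonal_succ']
    simp [coeff_ww_mul]

theorem diag_inZ_mul_inW (g : ℕ → ℂ) (a b : ℕ → A) :
    diag g (inZ a * inW b) = mk a * mk (fun n => g n • b n) := by
  ext N
  simp only [coeff_diag, coeff_inZ_inW]
  simp only [coeff_mul, coeff_mk, mul_smul_comm]

theorem diag_inW_mul_inZ (g : ℕ → ℂ) (a b : ℕ → A) :
    diag g (inW b * inZ a) = mk (fun n => g n • b n) * mk a := by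
  ext N
  simp only [coeff_diag, coeff_inW_inZ]
  simp only [coeff_mul, coeff_mk, smul_mul_assoc]
  rw [← Finset.Nat.sum_antidiagonal_swap]
  rfl

theorem mk_pow_smul (l : ℂ) (b : ℕ → A) : mk (fun n => l ^ n • b n) = dil l (mk b) := by
  ext n; simp

theorem mk_mul_pow_smul (l : ℂ) (b : ℕ → A) :
    mk (fun n => ((n : ℂ) * l ^ n) • b n) = euler (dil l (mk b)) := by
  ext n; simp [smul_smul]

theorem diag_pow_succ (l : ℂ) (W : A⟦X⟧⟦X⟧) :
    diag (fun n => l ^ (n + 1)) W = l • diag (fun n => l ^ n) W := by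
  ext N
  simp only [coeff_diag, PowerSeries.coeff_smul, Finset.smul_sum, smul_smul, pow_succ']

theorem diag_mul_pow_succ (l : ℂ) (W : A⟦X⟧⟦X⟧) :
    diag (fun n => ((n + 1 : ℕ) : ℂ) * l ^ (n + 1)) W =
      l • diag (fun n => (n : ℂ) * l ^ n) W + l • diag (fun n => l ^ n) W := by
  ext N
  simp only [coeff_diag, PowerSeries.coeff_smul, map_add, Finset.smul_sum, smul_smul,
    ← Finset.sum_add_distrib, ← add_smul]
  refine Finset.sum_congr rfl fun p _ => ?_
  congr 1
  push_cast
  ring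

/-- The RTT relation for a matrix `x(z)` of series on the line `w = l z`, where the `R`-matrix is
proportional to `R' + r R''`: `eval` is the restriction of the relation to this line, and `deriv`
is the restriction of its derivative under `w d/dw`.  The sign `ε` is `1` if the variables are the
spectral parameters, so that `r = l`, and `-1` if they are their inverses, so that `r = l⁻¹`.

The derivative of the `R`-matrix itself, divided by the same monomial, is `r R''` for `ε = 1` and
`R'` for `ε = -1`.  Subtracting a multiple of `eval` turns both into `-ε R'`, so that the two cases
have one form. -/
structure DiagonalRTT (q ε l r : ℂ) (x : Fin 2 → Fin 2 → A⟦X⟧) : Prop where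
  eval : ∀ i b k d, ∑ a, ∑ c, sgn a b k d •
      ((Rz q i a k c + r * Rw q i a k c) • (x a b * dil l (x c d))) =
    ∑ a, ∑ c, sgn k c a b •
      ((Rz q a b c d + r * Rw q a b c d) • (dil l (x k c) * x i a))
  deriv : ∀ i b k d, ∑ a, ∑ c, sgn a b k d •
      ((Rz q i a k c + r * Rw q i a k c) • (x a b * euler (dil l (x c d))) -
        (ε * Rz q i a k c) • (x a b * dil l (x c d))) =
    ∑ a, ∑ c, sgn k c a b •
      ((Rz q a b c d + r * Rw q a b c d) • (euler (dil l (x k c)) * x i a) -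
        (ε * Rz q a b c d) • (dil l (x k c) * x i a))

theorem diagonalRTT_up {q : ℂ} (x : Fin 2 → Fin 2 → ℕ → A)
    (h : ∀ m n i j k l, rttL q (upModes x) (upModes x) m n i j k l
        = rttR q (upModes x) (upModes x) m n i j k l) (l : ℂ) :
    DiagonalRTT q 1 l l fun i j => mk (x i j) := by
  have h' := (shape_ss.iff q x x).2 h
  have key : ∀ (g : ℕ → ℂ) (i j k m : Fin 2) (W : A⟦X⟧⟦X⟧), diag g (rho q zz ww i j k m * W) =
      X * (Rz q i j k m • diag g W + Rw q i j k m • diag (fun n => g (n + 1)) W) := by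
    intro g i j k m W
    simp only [rho, add_mul, smul_mul_assoc, map_add, map_smul, diag_zz_mul, diag_ww_mul, mul_add,
      mul_smul_comm]
  have e0 : ∀ i b k d, _ := fun i b k d => congrArg (diag fun n => l ^ n) (h' i b k d)
  have e1 : ∀ i b k d, _ := fun i b k d => congrArg (diag fun n => (n : ℂ) * l ^ n) (h' i b k d)
  simp only [← rho_comm q zz_comm ww_comm, map_sum, map_smul, key, diag_pow_succ,
    diag_mul_pow_succ] at e0 e1
  simp only [diag_inZ_mul_inW, diag_inW_mul_inZ, mk_pow_smul, mk_mul_pow_smul, smul_X_mul,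
    ← Finset.mul_sum] at e0 e1
  constructor
  · intro i b k d
    have e0 := X_mul_left_cancel (e0 i b k d)
    simp only [Fin.sum_univ_two] at e0 ⊢
    linear_combination (norm := module) e0
  · intro i b k d
    have e0 := X_mul_left_cancel (e0 i b k d)
    have e1 := X_mul_left_cancel (e1 i b k d)
    simp only [Fin.sum_univ_two] at e0 e1 ⊢
    linear_combination (norm := module) e1 - e0

theorem diagonalRTT_down {q : ℂ} (x : Fin 2 → Fin 2 → ℕ → A)
    (h : ∀ m n i j k l, rttL q (downModes x) (downModes x) m n i j k l
        = rttR q (downModes x) (downModes x) m n i j k l) {l : ℂ} (hl : l ≠ 0) :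
    DiagonalRTT q (-1) l l⁻¹ fun i j => mk (x i j) := by
  have h' := (shape_tt.iff q x x).2 h
  have key : ∀ (g : ℕ → ℂ) (i j k m : Fin 2) (W : A⟦X⟧⟦X⟧), diag g (rho q ww zz i j k m * W) =
      X * (Rz q i j k m • diag (fun n => g (n + 1)) W + Rw q i j k m • diag g W) := by
    intro g i j k m W
    simp only [rho, add_mul, smul_mul_assoc, map_add, map_smul, diag_zz_mul, diag_ww_mul, mul_add,
      mul_smul_comm]
  have e0 : ∀ i b k d, _ := fun i b k d => congrArg (diag fun n => l ^ n) (h' i b k d)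
  have e1 : ∀ i b k d, _ := fun i b k d => congrArg (diag fun n => (n : ℂ) * l ^ n) (h' i b k d)
  simp only [← rho_comm q ww_comm zz_comm, map_sum, map_smul, key, diag_pow_succ,
    diag_mul_pow_succ] at e0 e1
  simp only [diag_inZ_mul_inW, diag_inW_mul_inZ, mk_pow_smul, mk_mul_pow_smul, smul_X_mul,
    ← Finset.mul_sum] at e0 e1
  constructor
  · intro i b k d
    have e0 := X_mul_left_cancel (e0 i b k d)
    simp only [Fin.sum_univ_two] at e0 ⊢
    linear_combination (norm := (match_scalars <;> field_simp <;> ring)) l⁻¹ • e0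
  · intro i b k d
    have e0 := X_mul_left_cancel (e0 i b k d)
    have e1 := X_mul_left_cancel (e1 i b k d)
    simp only [Fin.sum_univ_two] at e0 e1 ⊢
    linear_combination (norm := (match_scalars <;> field_simp <;> ring)) l⁻¹ • e1

end diagonal

/-! ### Relations between the Gauss factors in one variable -/

section relations

variable {A : Type*} [Ring A] [Algebra ℂ A]

/-- A matrix `x(z)` of series that satisfies the RTT relations on the lines `w = z` and `w = l z`,
the latter being the line where the `R`-matrix is proportional to `R' + q² R''`, that is, where
its coefficient of `E_11 ⊗ E_11` vanishes; `u` is the constant term of `x_11(z)`. -/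
structure RTTSeries (q ε l : ℂ) (x : Matrix (Fin 2) (Fin 2) A⟦X⟧) (u : Aˣ) : Prop where
  q_ne : q ≠ 0
  q_sq : q ^ 2 - 1 ≠ 0
  q_four : q ^ 4 - 1 ≠ 0
  l_ne : l ≠ 0
  eps_ne : ε ≠ 0
  const : constantCoeff (x 0 0) = u
  commute_const : x 0 0 * C (u : A) = C (u : A) * x 0 0
  one : DiagonalRTT q ε 1 1 x
  line : DiagonalRTT q ε l (q ^ 2) x

/-- `φ = K_1⁻¹ K_2`, from the Gauss decomposition of `x`. -/
def gaussPhi (x : Matrix (Fin 2) (Fin 2) A⟦X⟧) (u : Aˣ) : A⟦X⟧ :=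
  invOfUnit (x 0 0) u * gaussK₂ x u

namespace RTTSeries

variable {q ε l : ℂ} {x : Matrix (Fin 2) (Fin 2) A⟦X⟧} {u : Aˣ} (h : RTTSeries q ε l x u)
include h

theorem isUnit : IsUnit (x 0 0) :=
  ⟨⟨x 0 0, invOfUnit (x 0 0) u, mul_invOfUnit _ _ h.const, invOfUnit_mul _ _ h.const⟩, rfl⟩

theorem isUnit_dil : IsUnit (dil l (x 0 0)) := h.isUnit.map _

theorem mul_gaussE : x 0 0 * gaussE x u = x 0 1 := by
  rw [gaussE, ← mul_assoc, mul_invOfUnit _ _ h.const, one_mul]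

theorem gaussF_mul : gaussF x u * x 0 0 = x 1 0 := by
  rw [gaussF, mul_assoc, invOfUnit_mul _ _ h.const, mul_one]

theorem gaussK₂_eq : gaussK₂ x u = x 1 1 + gaussF x u * x 0 0 * gaussE x u := by
  rw [gaussK₂, h.gaussF_mul, gaussE, mul_assoc]

theorem commute_euler : x 0 0 * euler (x 0 0) = euler (x 0 0) * x 0 0 := by
  have e := h.one.deriv 0 0 0 0
  simp only [Fin.sum_univ_two, Rz, Rw, sgn, qd, dil_one] at e
  simp at e
  have hq := h.q_ne
  have hk : q - q⁻¹ ≠ 0 := fun hk => h.q_sq (by field_simp at hk; simpa using hk)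
  exact smul_right_injective _ hk (by simpa [sub_eq_add_neg] using e)

theorem commute_dil : x 0 0 * dil l (x 0 0) = dil l (x 0 0) * x 0 0 := by
  have e := h.line.deriv 0 0 0 0
  simp only [Fin.sum_univ_two, Rz, Rw, sgn, qd] at e
  simp at e
  have hq := h.q_ne
  have hk : q + -(q ^ 2 * q⁻¹) = 0 := by field_simp; ring
  simp only [hk, zero_smul, zero_sub, neg_inj] at e
  exact smul_right_injective _ (mul_ne_zero h.eps_ne hq) e

/-- Conjugation by `K_1(z)` dilates `E(z)`. -/
theorem mul_gaussE_eq : x 0 0 * gaussE x u = q • (dil l (gaussE x u) * x 0 0) := by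
  have e := h.line.eval 0 0 0 1
  simp only [Fin.sum_univ_two, Rz, Rw, sgn, qd] at e
  simp at e
  have hq := h.q_ne
  have hk := h.q_sq
  rw [← h.mul_gaussE, map_mul] at e
  refine h.isUnit_dil.mul_left_cancel ?_
  linear_combination (norm := (
    simp only [mul_add, add_mul, mul_sub, sub_mul, smul_mul_assoc, mul_smul_comm, smul_add,
      smul_sub, smul_smul, mul_assoc, mul_zero, zero_mul, smul_zero, neg_mul, mul_neg]
    match_scalars <;> field_simp <;> ring)) -(q / (q ^ 2 - 1)) • e

/-- Conjugation by `K_1(z)` dilates `F(z)`. -/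
theorem gaussF_mul_eq : gaussF x u * x 0 0 = q⁻¹ • (x 0 0 * dil l (gaussF x u)) := by
  have e := h.line.eval 0 0 1 0
  simp only [Fin.sum_univ_two, Rz, Rw, sgn, qd] at e
  simp at e
  have hq := h.q_ne
  have hk := h.q_sq
  rw [← h.gaussF_mul, map_mul] at e
  refine h.isUnit_dil.mul_right_cancel ?_
  linear_combination (norm := (
    simp only [mul_add, add_mul, mul_sub, sub_mul, smul_mul_assoc, mul_smul_comm, smul_add,
      smul_sub, smul_smul, mul_assoc, mul_zero, zero_mul, smul_zero, neg_mul, mul_neg]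
    match_scalars <;> field_simp <;> ring)) (1 / (q * (q ^ 2 - 1))) • e

/-- The derivative on the line `w = z` of the relation between `x_11(z)` and `x_12(w)`, whose
restriction to that line is empty. -/
theorem mul_euler_gaussE : (q - q⁻¹) • (x 0 0 * euler (gaussE x u)) =
    ε • (q⁻¹ • (x 0 0 * gaussE x u) - gaussE x u * x 0 0) := by
  have e := h.one.deriv 0 0 0 1
  simp only [Fin.sum_univ_two, Rz, Rw, sgn, qd, dil_one] at e
  simp at e
  have hq := h.q_ne
  rw [← h.mul_gaussE, euler_mul] at e
  refine h.isUnit.mul_left_cancel ?_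
  linear_combination (norm := (
    simp only [mul_add, add_mul, mul_sub, sub_mul, smul_mul_assoc, mul_smul_comm, smul_add,
      smul_sub, smul_smul, mul_assoc, mul_zero, zero_mul, smul_zero, neg_mul, mul_neg]
    match_scalars <;> field_simp <;> ring)) e - (q - q⁻¹) • (h.commute_euler * gaussE x u)

/-- The derivative on the line `w = l z` of the relation between `x_11(z)` and `x_12(w)`. -/
theorem euler_dil_gaussE_mul : (q - q⁻¹) • (euler (dil l (gaussE x u)) * x 0 0) =
    ε • (x 0 0 * dil l (gaussE x u) - x 0 0 * gaussE x u) := by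
  have e := h.line.deriv 0 0 0 1
  simp only [Fin.sum_univ_two, Rz, Rw, sgn, qd] at e
  simp at e
  have hq := h.q_ne
  rw [← h.mul_gaussE, map_mul, euler_mul] at e
  refine h.isUnit_dil.mul_left_cancel ?_
  linear_combination (norm := (
    simp only [mul_add, add_mul, mul_sub, sub_mul, smul_mul_assoc, mul_smul_comm, smul_add,
      smul_sub, smul_smul, mul_assoc, mul_zero, zero_mul, smul_zero, neg_mul, mul_neg]
    match_scalars <;> field_simp <;> ring)) q⁻¹ • e + ε • (h.commute_dil * dil l (gaussE x u)) +
    (q⁻¹ * (q - q⁻¹)) • (euler (dil l (x 0 0)) * h.mul_gaussE_eq) +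
    (ε * q⁻¹ ^ 2) • (dil l (x 0 0) * h.mul_gaussE_eq)

/-- The derivative on the line `w = z` of the relation between `x_11(z)` and `x_21(w)`. -/
theorem euler_gaussF_mul : (q - q⁻¹) • (euler (gaussF x u) * x 0 0) =
    ε • (q • (gaussF x u * x 0 0) - x 0 0 * gaussF x u) := by
  have e := h.one.deriv 0 0 1 0
  simp only [Fin.sum_univ_two, Rz, Rw, sgn, qd, dil_one] at e
  simp at e
  have hq := h.q_ne
  rw [← h.gaussF_mul, euler_mul] at e
  refine h.isUnit.mul_right_cancel ?_
  linear_combination (norm := (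
    simp only [mul_add, add_mul, mul_sub, sub_mul, smul_mul_assoc, mul_smul_comm, smul_add,
      smul_sub, smul_smul, mul_assoc, mul_zero, zero_mul, smul_zero, neg_mul, mul_neg]
    match_scalars <;> field_simp <;> ring)) (q - q⁻¹) • (gaussF x u * h.commute_euler) - e

/-- On the line `w = z` the relation between `x_12(z)` and `x_12(w)` is empty; the line `w = l z`
gives `x_12(l z) x_12(z) = 0`, from which the shift by `l` is removed by `mul_gaussE_eq`. -/
theorem gaussE_mul_self : gaussE x u * gaussE x u = 0 := by
  have e := h.line.eval 0 1 0 1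
  simp only [Fin.sum_univ_two, Rz, Rw, sgn, qd] at e
  simp at e
  have hq := h.q_ne
  have hk := h.q_four
  rw [← h.mul_gaussE, map_mul] at e
  refine dil_injective h.l_ne (h.isUnit_dil.mul_left_cancel (h.isUnit.mul_right_cancel ?_))
  rw [map_mul, map_zero]
  linear_combination (norm := (
    simp only [mul_add, add_mul, mul_sub, sub_mul, smul_mul_assoc, mul_smul_comm, smul_add,
      smul_sub, smul_smul, mul_assoc, mul_zero, zero_mul, smul_zero, neg_mul, mul_neg]
    match_scalars <;> field_simp <;> ring)) (1 / (q ^ 4 - 1)) • e -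
    q⁻¹ • (dil l (x 0 0) * dil l (gaussE x u) * h.mul_gaussE_eq)

/-- Obtained like `gaussE_mul_self`, from `x_21(z) x_21(l z) = 0`. -/
theorem gaussF_mul_self : gaussF x u * gaussF x u = 0 := by
  have e := h.line.eval 1 0 1 0
  simp only [Fin.sum_univ_two, Rz, Rw, sgn, qd] at e
  simp at e
  have hq := h.q_ne
  have hk := h.q_four
  rw [← h.gaussF_mul, map_mul] at e
  refine dil_injective h.l_ne (h.isUnit.mul_left_cancel (h.isUnit_dil.mul_right_cancel ?_))
  rw [map_mul, map_zero]
  linear_combination (norm := (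
    simp only [mul_add, add_mul, mul_sub, sub_mul, smul_mul_assoc, mul_smul_comm, smul_add,
      smul_sub, smul_smul, mul_assoc, mul_zero, zero_mul, smul_zero, neg_mul, mul_neg]
    match_scalars <;> field_simp <;> ring)) (q ^ 2 / (q ^ 4 - 1)) • e -
    q • (h.gaussF_mul_eq * (dil l (gaussF x u) * dil l (x 0 0)))

/-- `K_1(z)` and `K_2(z)` commute.  On the line `w = z` the relation between `x_11(z)` and `x_22(w)`
is empty, so its derivative is used. -/
theorem commute_gaussK₂ : x 0 0 * gaussK₂ x u = gaussK₂ x u * x 0 0 := by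
  have e := h.one.deriv 0 0 1 1
  simp only [Fin.sum_univ_two, Rz, Rw, sgn, qd, dil_one] at e
  simp at e
  have hq := h.q_ne
  rw [← h.mul_gaussE, ← h.gaussF_mul, euler_mul, euler_mul] at e
  rw [h.gaussK₂_eq]
  refine smul_right_injective _ h.eps_ne ?_
  linear_combination (norm := (
    simp only [mul_add, add_mul, mul_sub, sub_mul, smul_mul_assoc, mul_smul_comm, smul_add,
      smul_sub, smul_smul, mul_assoc, mul_zero, zero_mul, smul_zero, neg_mul, mul_neg]
    match_scalars <;> field_simp <;> ring))
    h.euler_gaussF_mul * (x 0 0 * gaussE x u) - gaussF x u * x 0 0 * h.mul_euler_gaussE -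
      (q - q⁻¹) • (gaussF x u * h.commute_euler * gaussE x u) - e

/-- The main part of the statement that `φ(z)` commutes with `x_12(z)`.  Again only the derivatives
of the relations contribute; the derivative of `x_22` cancels between the two that are used. -/
theorem mul_gaussK₂ : x 0 1 * gaussK₂ x u = x 1 1 * gaussE x u * x 0 0 := by
  have e := h.one.deriv 0 1 1 0
  have e' := h.one.deriv 0 1 1 1
  simp only [Fin.sum_univ_two, Rz, Rw, sgn, qd, dil_one] at e e'
  simp [show (-1 : ℂ) ^ 4 = 1 by norm_num] at e e'
  have hq := h.q_ne
  rw [← h.mul_gaussE, ← h.gaussF_mul] at e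
  rw [← h.mul_gaussE, euler_mul] at e'
  rw [h.gaussK₂_eq, ← h.mul_gaussE]
  refine smul_right_injective _ h.eps_ne ?_
  linear_combination (norm := (
    simp only [mul_add, add_mul, mul_sub, sub_mul, smul_mul_assoc, mul_smul_comm, smul_add,
      smul_sub, smul_smul, mul_assoc, mul_zero, zero_mul, smul_zero, neg_mul, mul_neg]
    match_scalars <;> field_simp <;> ring))
    e * gaussE x u - e' - x 1 1 * h.mul_euler_gaussE -
      ε • (gaussF x u * x 0 0 * x 0 0 * h.gaussE_mul_self)

theorem mul_gaussPhi : x 0 0 * gaussPhi x u = gaussK₂ x u := by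
  rw [gaussPhi, ← mul_assoc, mul_invOfUnit _ _ h.const, one_mul]

theorem gaussPhi_mul : gaussPhi x u * x 0 0 = gaussK₂ x u := by
  rw [gaussPhi, mul_assoc, ← h.commute_gaussK₂, ← mul_assoc, invOfUnit_mul _ _ h.const, one_mul]

/-- `φ(z)` commutes with `x_12(z) = K_1(z) E(z)`, stated in terms of the entries of `x`. -/
theorem mul_gaussPhi_eq : x 0 1 * gaussPhi x u = x 1 1 * gaussE x u := by
  refine h.isUnit.mul_right_cancel ?_
  rw [mul_assoc, h.gaussPhi_mul, h.mul_gaussK₂]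

/-- The bracket of `E(z)` with the logarithmic derivative `a = K_1⁻¹ (z d/dz) K_1`, whose
coefficients are the `h_s` up to scalars. -/
theorem gaussE_bracket {a : A⟦X⟧} (ha : x 0 0 * a = euler (x 0 0)) :
    gaussE x u * a - a * gaussE x u - euler (gaussE x u) =
      -(ε * q / (q - q⁻¹)) • (dil l (gaussE x u) - gaussE x u) := by
  have hq := h.q_ne
  have hk := h.q_sq
  have e := congrArg euler h.mul_gaussE_eq
  rw [map_smul, euler_mul, euler_mul] at e
  refine h.isUnit.mul_left_cancel ?_
  linear_combination (norm := (
    simp only [mul_add, add_mul, mul_sub, sub_mul, smul_mul_assoc, mul_smul_comm, smul_add,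
      smul_sub, smul_smul, mul_assoc, mul_zero, zero_mul, smul_zero, neg_mul, mul_neg]
    match_scalars <;> field_simp <;> ring))
    h.mul_gaussE_eq * a + q • (dil l (gaussE x u) * ha) - ha * gaussE x u - e -
      (q / (q - q⁻¹)) • h.euler_dil_gaussE_mul

/-- The bracket of `F(l z)` with the logarithmic derivative `a = K_1⁻¹ (z d/dz) K_1`. -/
theorem gaussF_bracket {a : A⟦X⟧} (ha : x 0 0 * a = euler (x 0 0)) :
    dil l (gaussF x u) * a - a * dil l (gaussF x u) - euler (dil l (gaussF x u)) =
      -(ε * q / (q - q⁻¹)) • (dil l (gaussF x u) - gaussF x u) := by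
  have hq := h.q_ne
  have hk := h.q_sq
  have e := congrArg euler h.gaussF_mul_eq
  rw [map_smul, euler_mul, euler_mul] at e
  refine h.isUnit.mul_left_cancel ?_
  linear_combination (norm := (
    simp only [mul_add, add_mul, mul_sub, sub_mul, smul_mul_assoc, mul_smul_comm, smul_add,
      smul_sub, smul_smul, mul_assoc, mul_zero, zero_mul, smul_zero, neg_mul, mul_neg]
    match_scalars <;> field_simp <;> ring))
    q • (gaussF x u * ha) - q • (h.gaussF_mul_eq * a) - ha * dil l (gaussF x u) + q • e -
      (q / (q - q⁻¹)) • h.euler_gaussF_mul - (ε * q ^ 2 / (q - q⁻¹)) • h.gaussF_mul_eq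

/-- The logarithmic derivative of `K_1(z)` is `z d/dz` of its normalized logarithm. -/
theorem mul_euler_psLog :
    x 0 0 * euler (psLog (C (↑u⁻¹ : A) * x 0 0)) = euler (x 0 0) := by
  have hu : C (u : A) * C (↑u⁻¹ : A) = 1 := by rw [← map_mul, Units.mul_inv, map_one]
  have hu' : C (↑u⁻¹ : A) * C (u : A) = 1 := by rw [← map_mul, Units.inv_mul, map_one]
  have hc : x 0 0 * C (↑u⁻¹ : A) = C (↑u⁻¹ : A) * x 0 0 := by
    calc _ = C (↑u⁻¹ : A) * (C (u : A) * x 0 0) * C (↑u⁻¹ : A) := by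
          rw [← mul_assoc (C _), hu', one_mul]
      _ = _ := by rw [← h.commute_const, mul_assoc, mul_assoc, hu, mul_one]
  have hc' : euler (x 0 0) * C (↑u⁻¹ : A) = C (↑u⁻¹ : A) * euler (x 0 0) := by
    simpa [euler_mul, euler_C] using congrArg euler hc
  have e : euler (C (↑u⁻¹ : A) * x 0 0) = C (↑u⁻¹ : A) * euler (x 0 0) := by
    rw [euler_mul, euler_C, zero_mul, zero_add]
  have key := QAffGL.mul_euler_psLog (f := C (↑u⁻¹ : A) * x 0 0)
    (by rw [map_mul, h.const, constantCoeff_C, Units.inv_mul]) (by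
      rw [e]
      change _ * _ = _ * _
      rw [mul_assoc, ← mul_assoc (x 0 0), hc, mul_assoc, mul_assoc, ← mul_assoc (euler _), hc',
        mul_assoc, h.commute_euler])
  have := congrArg (C (u : A) * ·) key
  simpa only [e, ← mul_assoc, hu, one_mul] using this

end RTTSeries

end relations

/-! ### The coproduct of the Gauss factors -/

section coproductOfGauss

variable {q : ℂ}

/-- The series `f(z) ⊗ 1`. -/
def serL (q : ℂ) : (U q)⟦X⟧ →ₐ[ℂ] (U2 q)⟦X⟧ := mapAlgHom (inclL q)

/-- The series `1 ⊗ f(z)`. -/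
def serR (q : ℂ) : (U q)⟦X⟧ →ₐ[ℂ] (U2 q)⟦X⟧ := mapAlgHom (inclR q)

/-- The coproduct of series, as an algebra morphism; see `comulSer_eq`. -/
def serΔ (q : ℂ) : (U q)⟦X⟧ →ₐ[ℂ] (U2 q)⟦X⟧ := mapAlgHom (comul q)

theorem coeff_serL (f : (U q)⟦X⟧) (n : ℕ) : coeff n (serL q f) = inclL q (coeff n f) := by
  rw [serL, mapAlgHom_apply, coeff_map]; rfl

theorem coeff_serR (f : (U q)⟦X⟧) (n : ℕ) : coeff n (serR q f) = inclR q (coeff n f) := by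
  rw [serR, mapAlgHom_apply, coeff_map]; rfl

theorem coeff_serΔ (f : (U q)⟦X⟧) (n : ℕ) : coeff n (serΔ q f) = comul q (coeff n f) := by
  rw [serΔ, mapAlgHom_apply, coeff_map]; rfl

theorem inclL_mul_inclR (x y : U q) : inclL q x * inclR q y = x ᵍ⊗ₜ[ℂ] y :=
  GradedTensorProduct.tmul_one_mul_one_tmul (grade q) (grade q) x y

theorem comulSer_eq (f : (U q)⟦X⟧) : comulSer q f = serΔ q f := by
  ext n
  rw [coeff_serΔ, comulSer, coeff_mk]

theorem tens_eq (f g : (U q)⟦X⟧) : tens q f g = serL q f * serR q g := by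
  ext n
  simp only [tens, coeff_mk, coeff_mul, coeff_serL, coeff_serR, inclL_mul_inclR]

/-- The series `f` has coefficients of parity `p`. -/
def HasParity (p : ℕ) (f : (U q)⟦X⟧) : Prop :=
  mapAlgHom (parityAut q) f = (-1 : ℂ) ^ p • f

namespace HasParity

variable {p p' : ℕ} {f g : (U q)⟦X⟧}

theorem coeff_mem (hf : HasParity p f) (n : ℕ) : coeff n f ∈ grade q (p : ZMod 2) := by
  have := congrArg (coeff n) hf
  rw [mapAlgHom_apply, coeff_map, PowerSeries.coeff_smul] at this
  rw [mem_grade, ZMod.val_natCast, ← neg_one_pow_eq_pow_mod_two]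
  exact this

theorem mul (hf : HasParity p f) (hg : HasParity p' g) : HasParity (p + p') (f * g) := by
  rw [HasParity, map_mul, hf, hg, smul_mul_smul_comm, pow_add]

theorem add (hf : HasParity p f) (hg : HasParity p g) : HasParity p (f + g) := by
  rw [HasParity, map_add, hf, hg, smul_add]

theorem euler (hf : HasParity p f) : HasParity p (euler f) := by
  rw [HasParity, ← euler_mapAlgHom, hf, map_smul]

theorem dil (hf : HasParity p f) (l : ℂ) : HasParity p (dil l f) := by
  rw [HasParity, mapAlgHom_dil, hf, map_smul]

theorem of_mul_eq_one (hf : HasParity 0 f) (h : f * g = 1) (h' : g * f = 1) : HasParity 0 g := by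
  rw [HasParity, pow_zero, one_smul] at hf ⊢
  have e := congrArg (mapAlgHom (parityAut q)) h
  rw [map_mul, hf, map_one] at e
  calc _ = g * f * mapAlgHom (parityAut q) g := by rw [h', one_mul]
    _ = g := by rw [mul_assoc, e, mul_one]

theorem C {a : U q} (ha : a ∈ grade q 0) : HasParity 0 (PowerSeries.C a) := by
  rw [HasParity, mapAlgHom_apply, map_C, pow_zero, one_smul]
  exact congrArg _ ((mem_grade_zero q a).1 ha)

theorem two (hf : HasParity 2 f) : HasParity 0 f := by
  rw [HasParity] at hf ⊢
  rw [hf]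
  norm_num

end HasParity

/-- The Koszul sign rule for series. -/
theorem serR_mul_serL {p p' : ℕ} {f g : (U q)⟦X⟧} (hf : HasParity p f) (hg : HasParity p' g) :
    serR q g * serL q f = (-1 : ℂ) ^ (p * p') • (serL q f * serR q g) := by
  have key : ∀ (N : ℕ) (v : U2 q), ((-1 : ℤˣ) ^ (N : ZMod 2)) • v = ((-1 : ℂ) ^ N) • v := by
    intro N v
    rw [uzpow_natCast, Units.smul_def, ← Int.cast_smul_eq_zsmul ℂ]
    simp
  ext n
  rw [PowerSeries.coeff_smul, coeff_mul, coeff_mul, Finset.smul_sum,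
    ← Finset.Nat.sum_antidiagonal_swap]
  refine Finset.sum_congr rfl fun r _ => ?_
  simp only [Prod.fst_swap, Prod.snd_swap, coeff_serL, coeff_serR, inclL_mul_inclR]
  have h1 := GradedTensorProduct.tmul_coe_mul_coe_tmul (R := ℂ) (𝒜 := grade q) (ℬ := grade q)
    (1 : U q) ⟨_, hg.coeff_mem r.2⟩ ⟨_, hf.coeff_mem r.1⟩ (1 : U q)
  simp only [one_mul, mul_one] at h1
  rw [← Nat.cast_mul, key, mul_comm p'] at h1
  exact h1

theorem serR_mul_serL_even {p : ℕ} {f g : (U q)⟦X⟧} (hf : HasParity p f) (hg : HasParity 0 g) :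
    serR q g * serL q f = serL q f * serR q g := by
  rw [serR_mul_serL hf hg, mul_zero, pow_zero, one_smul]

theorem serR_mul_serL_even' {p : ℕ} {f g : (U q)⟦X⟧} (hf : HasParity 0 f) (hg : HasParity p g) :
    serR q g * serL q f = serL q f * serR q g := by
  rw [serR_mul_serL hf hg, zero_mul, pow_zero, one_smul]

theorem serR_mul_serL_odd {f g : (U q)⟦X⟧} (hf : HasParity 1 f) (hg : HasParity 1 g) :
    serR q g * serL q f = -(serL q f * serR q g) := by
  rw [serR_mul_serL hf hg, mul_one, pow_one, neg_smul, one_smul]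

/-- If `f` is even and grouplike, then its normalized logarithm is primitive. -/
theorem serΔ_psLog_of_grouplike {f : (U q)⟦X⟧} {u : (U q)ˣ} (hu : constantCoeff f = u)
    (hf : HasParity 0 f) (hΔ : serΔ q f = serL q f * serR q f) :
    serΔ q (psLog (C (↑u⁻¹ : U q) * f)) =
      serR q (psLog (C (↑u⁻¹ : U q) * f)) + serL q (psLog (C (↑u⁻¹ : U q) * f)) := by
  have u1 : C (u : U q) * C (↑u⁻¹ : U q) = 1 := by rw [← map_mul, Units.mul_inv, map_one]
  have u2 : C (↑u⁻¹ : U q) * C (u : U q) = 1 := by rw [← map_mul, Units.inv_mul, map_one]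
  have pu : HasParity 0 (C (u : U q)) := by
    refine HasParity.C ?_
    have := hf.coeff_mem 0
    rwa [coeff_zero_eq_constantCoeff_apply, hu, Nat.cast_zero] at this
  have pu' := pu.of_mul_eq_one u1 u2
  set g := C (↑u⁻¹ : U q) * f with hg
  have pg : HasParity 0 g := pu'.mul hf
  have hfg : C (u : U q) * g = f := by rw [hg, ← mul_assoc, u1, one_mul]
  have h1 : constantCoeff g = 1 := by rw [hg, map_mul, hu, constantCoeff_C, Units.inv_mul]
  have mapC : ∀ (φ : U q →ₐ[ℂ] U2 q) (a : U q), mapAlgHom φ (C a) = C (φ a) := fun φ a => by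
    rw [mapAlgHom_apply, map_C]; rfl
  have Δu : serΔ q (C (u : U q)) = serL q (C (u : U q)) * serR q (C (u : U q)) := by
    have := congrArg (coeff 0) hΔ
    rw [coeff_serΔ, coeff_mul, Finset.Nat.antidiagonal_zero, Finset.sum_singleton, coeff_serL,
      coeff_serR] at this
    simp only [coeff_zero_eq_constantCoeff_apply, hu] at this
    rw [serΔ, serL, serR, mapC, mapC, mapC, this, map_mul]
  have Δg : serΔ q g = serL q g * serR q g := by
    have un : IsUnit (serΔ q (C (u : U q))) :=
      (show IsUnit (C (u : U q)) from ⟨⟨_, _, u1, u2⟩, rfl⟩).map _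
    refine un.mul_left_cancel ?_
    rw [← map_mul, hfg, hΔ, Δu, mul_assoc, ← mul_assoc (serR q _), serR_mul_serL_even pg pu,
      mul_assoc, ← map_mul, hfg, ← mul_assoc, ← map_mul, hfg]
  have hc : ∀ φ : U q →ₐ[ℂ] U2 q, constantCoeff (mapAlgHom φ g) = 1 := fun φ => by
    rw [mapAlgHom_apply, ← coeff_zero_eq_constantCoeff_apply, coeff_map,
      coeff_zero_eq_constantCoeff_apply, h1, map_one]
  have e : ∀ φ : U q →ₐ[ℂ] U2 q, mapAlgHom φ (psLog g) = psLog (mapAlgHom φ g) := fun φ =>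
    map_psLog φ g
  rw [serΔ, e, ← serΔ, Δg, psLog_mul (serR_mul_serL_even pg pg).symm (hc _) (hc _), add_comm,
    serL, serR, e, e]

theorem gaussK₂_eq_add (x : Matrix (Fin 2) (Fin 2) (U q)⟦X⟧) (u : (U q)ˣ) :
    gaussK₂ x u = x 1 1 + x 1 0 * gaussE x u := by
  rw [gaussK₂, gaussE, mul_assoc]

/-- A matrix of series over `U` that satisfies the RTT relations, has entries of the expected
parities and the matrix coproduct. -/
structure RTTCoproduct (q ε l : ℂ) (x : Matrix (Fin 2) (Fin 2) (U q)⟦X⟧) (u : (U q)ˣ) : Prop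
    extends RTTSeries q ε l x u where
  parity : ∀ i j : Fin 2, HasParity ((i : ℕ) + j) (x i j)
  comul : ∀ i j, serΔ q (x i j) = ∑ k, sgn i k k j • (serL q (x i k) * serR q (x k j))

namespace RTTCoproduct

variable {ε l : ℂ} {x : Matrix (Fin 2) (Fin 2) (U q)⟦X⟧} {u : (U q)ˣ} (h : RTTCoproduct q ε l x u)
include h

theorem comul00 : serΔ q (x 0 0) =
    serL q (x 0 0) * serR q (x 0 0) - serL q (x 0 1) * serR q (x 1 0) := by
  rw [h.comul, Fin.sum_univ_two]
  simp [sgn, sub_eq_add_neg]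

theorem comul01 : serΔ q (x 0 1) =
    serL q (x 0 0) * serR q (x 0 1) + serL q (x 0 1) * serR q (x 1 1) := by
  rw [h.comul, Fin.sum_univ_two]
  simp [sgn]

theorem comul10 : serΔ q (x 1 0) =
    serL q (x 1 0) * serR q (x 0 0) + serL q (x 1 1) * serR q (x 1 0) := by
  rw [h.comul, Fin.sum_univ_two]
  simp [sgn]

theorem comul11 : serΔ q (x 1 1) =
    serL q (x 1 1) * serR q (x 1 1) - serL q (x 1 0) * serR q (x 0 1) := by
  rw [h.comul, Fin.sum_univ_two]
  simp [sgn, show (-1 : ℂ) ^ 4 = 1 by norm_num]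
  abel

theorem parity00 : HasParity 0 (x 0 0) := h.parity 0 0
theorem parity01 : HasParity 1 (x 0 1) := h.parity 0 1
theorem parity10 : HasParity 1 (x 1 0) := h.parity 1 0
theorem parity11 : HasParity 0 (x 1 1) := (h.parity 1 1).two

theorem parity_inv : HasParity 0 (invOfUnit (x 0 0) u) :=
  h.parity00.of_mul_eq_one (mul_invOfUnit _ _ h.const) (invOfUnit_mul _ _ h.const)

theorem parity_gaussE : HasParity 1 (gaussE x u) := h.parity_inv.mul h.parity01

theorem parity_gaussF : HasParity 1 (gaussF x u) := h.parity10.mul h.parity_inv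

theorem parity_gaussPhi : HasParity 0 (gaussPhi x u) :=
  h.parity_inv.mul (h.parity11.add (h.parity_gaussF.mul h.parity01).two)

theorem isUnit_comul : IsUnit (serΔ q (x 0 0)) := h.isUnit.map _

theorem serΔ_gaussE : serΔ q (gaussE x u) =
    serR q (gaussE x u) + serL q (gaussE x u) * serR q (gaussPhi x u) := by
  have e0 := congrArg (serΔ q) h.mul_gaussE
  have e1 := congrArg (serL q) h.mul_gaussE
  have e2 := congrArg (serR q) h.mul_gaussE
  have e3 := serR_mul_serL_even h.parity_gaussE h.parity00
  have e4 := serR_mul_serL_odd h.parity_gaussE h.parity10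
  have e5 := congrArg (serR q) h.mul_gaussPhi
  have e6 := congrArg (serR q) (gaussK₂_eq_add x u)
  have e7 := congrArg (serL q) h.gaussE_mul_self
  simp only [map_mul, map_add, map_zero] at e0 e1 e2 e5 e6 e7
  refine h.isUnit_comul.mul_left_cancel ?_
  rw [e0, h.comul00, h.comul01]
  set La := serL q (x 0 0)
  set Lb := serL q (x 0 1)
  set LE := serL q (gaussE x u)
  set Ra := serR q (x 0 0)
  set Rc := serR q (x 1 0)
  set Rφ := serR q (gaussPhi x u)
  linear_combination (norm := noncomm_ring) -(La * e2) - La * e3 * Rφ - e1 * Ra * Rφ - Lb * e5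
    - Lb * e6 + Lb * e4 * Rφ + e1 * (LE * Rc * Rφ) - La * e7 * (Rc * Rφ)

theorem serΔ_gaussF : serΔ q (gaussF x u) =
    serL q (gaussPhi x u) * serR q (gaussF x u) + serL q (gaussF x u) := by
  have e0 := congrArg (serΔ q) h.gaussF_mul
  have e1 := congrArg (serL q) h.gaussF_mul
  have e2 := congrArg (serR q) h.gaussF_mul
  have e3 := serR_mul_serL_even' h.parity00 h.parity_gaussF
  have e4 := serR_mul_serL_odd h.parity01 h.parity_gaussF
  have e5 := congrArg (serL q) h.gaussPhi_mul
  have e6 := congrArg (serL q) (show gaussK₂ x u = x 1 1 + gaussF x u * x 0 1 from rfl)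
  have e7 := congrArg (serR q) h.gaussF_mul_self
  simp only [map_mul, map_add, map_zero] at e0 e1 e2 e5 e6 e7
  refine h.isUnit_comul.mul_right_cancel ?_
  rw [e0, h.comul00, h.comul10]
  set La := serL q (x 0 0)
  set Lb := serL q (x 0 1)
  set LF := serL q (gaussF x u)
  set Lφ := serL q (gaussPhi x u)
  set Ra := serR q (x 0 0)
  set Rc := serR q (x 1 0)
  set RF := serR q (gaussF x u)
  linear_combination (norm := noncomm_ring) -(e1 * Ra) - Lφ * e3 * Ra - Lφ * La * e2 - e5 * Rc
    - e6 * Rc + Lφ * e4 * Rc + Lφ * Lb * RF * e2 - Lφ * Lb * e7 * Ra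

theorem serΔ_gaussPhi : serΔ q (gaussPhi x u) =
    serL q (gaussPhi x u) * serR q (gaussPhi x u) := by
  have e0 := congrArg (serΔ q) h.mul_gaussPhi
  have e2 := congrArg (serR q) h.mul_gaussE
  have e3 := serR_mul_serL_even h.parity_gaussE h.parity00
  have e4 := serR_mul_serL_odd h.parity_gaussE h.parity10
  have e5 := congrArg (serR q) h.mul_gaussPhi
  have e5' := congrArg (serL q) h.mul_gaussPhi
  have e6 := congrArg (serR q) (gaussK₂_eq_add x u)
  have e6' := congrArg (serL q) (gaussK₂_eq_add x u)
  have e7 := congrArg (serΔ q) (gaussK₂_eq_add x u)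
  have e8 := congrArg (serL q) h.mul_gaussPhi_eq
  have e9 := serR_mul_serL_even' h.parity_gaussPhi h.parity00
  have e10 := serR_mul_serL_even' h.parity_gaussPhi h.parity10
  simp only [map_mul, map_add] at e0 e2 e5 e5' e6 e6' e7 e8
  refine h.isUnit_comul.mul_left_cancel ?_
  rw [e0, e7, h.serΔ_gaussE, h.comul00, h.comul11, h.comul10]
  set La := serL q (x 0 0)
  set Lb := serL q (x 0 1)
  set Lc := serL q (x 1 0)
  set Ld := serL q (x 1 1)
  set LE := serL q (gaussE x u)
  set LK := serL q (gaussK₂ x u)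
  set Lφ := serL q (gaussPhi x u)
  set Ra := serR q (x 0 0)
  set Rc := serR q (x 1 0)
  set RK := serR q (gaussK₂ x u)
  set Rφ := serR q (gaussPhi x u)
  linear_combination (norm := noncomm_ring) Lc * e2 + Lc * e3 * Rφ + Lc * LE * e5 + Ld * e4 * Rφ
    - Ld * e6 - e6' * RK - e5' * RK - La * Lφ * e5 - La * e9 * Rφ + Lb * e10 * Rφ + e8 * Rc * Rφ

/-- The coproduct of the logarithm of `K_1(z)`, after applying `z d/dz`.  No
Baker-Campbell-Hausdorff series appears, because `K_1(z)` commutes with its derivative, hence so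
does its coproduct. -/
theorem euler_serΔ_psLog :
    euler (serΔ q (psLog (C (↑u⁻¹ : U q) * x 0 0))) =
      serR q (euler (psLog (C (↑u⁻¹ : U q) * x 0 0))) +
        serL q (euler (psLog (C (↑u⁻¹ : U q) * x 0 0))) -
      (ε / (q - q⁻¹)) • (serL q (dil l (gaussE x u)) * serR q (dil l (gaussF x u)) -
        serL q (gaussE x u) * serR q (gaussF x u)) := by
  have hq := h.q_ne
  have hk := h.q_sq
  have ha := h.mul_euler_psLog
  set α := euler (psLog (C (↑u⁻¹ : U q) * x 0 0)) with hα
  have pα : HasParity 0 α := by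
    have : α = invOfUnit (x 0 0) u * euler (x 0 0) := by
      rw [← ha, ← mul_assoc, invOfUnit_mul _ _ h.const, one_mul]
    rw [this]
    exact h.parity_inv.mul h.parity00.euler
  have hD : euler (serΔ q (psLog (C (↑u⁻¹ : U q) * x 0 0))) = serΔ q α := euler_mapAlgHom _ _
  have eL : euler (serL q (x 0 0)) = serL q (x 0 0) * serL q α := by
    rw [← map_mul, ha]; exact euler_mapAlgHom _ _
  have eR : euler (serR q (x 0 0)) = serR q (x 0 0) * serR q α := by
    rw [← map_mul, ha]; exact euler_mapAlgHom _ _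
  have eE : euler (serL q (gaussE x u)) = serL q (euler (gaussE x u)) := euler_mapAlgHom _ _
  have eF : euler (serR q (dil l (gaussF x u))) = serR q (euler (dil l (gaussF x u))) :=
    euler_mapAlgHom _ _
  have c1 := serR_mul_serL_even pα h.parity00
  have c2 := serR_mul_serL_even' pα (h.parity_gaussF.dil l)
  have c3 := serR_mul_serL_even h.parity_gaussE pα
  have c4 := serR_mul_serL_odd h.parity_gaussE (h.parity_gaussF.dil l)
  have c5 := serR_mul_serL_odd (h.parity_gaussE.dil l) (h.parity_gaussF.dil l)
  have c6 := serR_mul_serL_even h.parity_gaussE h.parity00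
  have bE := congrArg (serL q) (h.gaussE_bracket ha)
  have bF := congrArg (serR q) (h.gaussF_bracket ha)
  have sE := congrArg (serL q) h.gaussE_mul_self
  have sF := congrArg (fun f => serR q (dil l f)) h.gaussF_mul_self
  have h1 := congrArg (serL q) h.mul_gaussE
  have h2 := congrArg (serR q) (h.gaussF_mul.symm.trans h.gaussF_mul_eq)
  simp only [map_mul, map_sub, map_smul, map_zero] at bE bF sE sF h1 h2
  have hΔ : serΔ q (x 0 0) = serL q (x 0 0) * serR q (x 0 0) -
      serL q (x 0 0) * serR q (x 0 0) *
        (q⁻¹ • (serL q (gaussE x u) * serR q (dil l (gaussF x u)))) := by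
    rw [h.comul00, ← h1, h2]
    linear_combination (norm := (
    simp only [mul_add, add_mul, mul_sub, sub_mul, smul_mul_assoc, mul_smul_comm, smul_add,
      smul_sub, smul_smul, mul_assoc, mul_zero, zero_mul, smul_zero, neg_mul, mul_neg, smul_neg]
    match_scalars <;> (try field_simp) <;> ring))
      q⁻¹ • (serL q (x 0 0) * c6 * serR q (dil l (gaussF x u)))
  set La := serL q (x 0 0)
  set Ra := serR q (x 0 0)
  set LE := serL q (gaussE x u)
  set LE' := serL q (dil l (gaussE x u))
  set LdE := serL q (euler (gaussE x u))
  set RF := serR q (gaussF x u)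
  set RF' := serR q (dil l (gaussF x u))
  set RdF := serR q (euler (dil l (gaussF x u)))
  set Lα := serL q α
  set Rα := serR q α
  -- `e` is the nilpotent part of the coproduct of `K_1`: this is `(K_1 ⊗ K_1) (1 - e)`
  set e := q⁻¹ • (LE * RF') with he
  have hM : euler (La * Ra) = La * Ra * (Lα + Rα) := by
    rw [euler_mul, eL, eR]
    linear_combination (norm := (
    simp only [mul_add, add_mul, mul_sub, sub_mul, smul_mul_assoc, mul_smul_comm, smul_add,
      smul_sub, smul_smul, mul_assoc, mul_zero, zero_mul, smul_zero, neg_mul, mul_neg, smul_neg]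
    match_scalars <;> (try field_simp) <;> ring)) -(La * c1)
  have hde : euler e = q⁻¹ • (LdE * RF' + LE * RdF) := by
    rw [he, map_smul, euler_mul, eE, eF]
  -- `t` is the correction to primitivity; `het` and `hbr` say that
  -- `(1 - e) (α ⊗ 1 + 1 ⊗ α - t)` differs from `(α ⊗ 1 + 1 ⊗ α) (1 - e)` by the derivative of `e`
  set t := (ε / (q - q⁻¹)) • (LE' * RF' - LE * RF) with ht
  have het : e * t = 0 := by
    rw [he, ht]
    linear_combination (norm := (
    simp only [mul_add, add_mul, mul_sub, sub_mul, smul_mul_assoc, mul_smul_comm, smul_add,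
      smul_sub, smul_smul, mul_assoc, mul_zero, zero_mul, smul_zero, neg_mul, mul_neg, smul_neg]
    match_scalars <;> (try field_simp) <;> ring))
      (q⁻¹ * (ε / (q - q⁻¹))) • (LE * c5 * RF' - LE * c4 * RF
      - LE * LE' * sF + sE * RF' * RF)
  have hbr : e * (Lα + Rα) - (Lα + Rα) * e - euler e = -t := by
    rw [hde, he, ht]
    linear_combination (norm := (
    simp only [mul_add, add_mul, mul_sub, sub_mul, smul_mul_assoc, mul_smul_comm, smul_add,
      smul_sub, smul_smul, mul_assoc, mul_zero, zero_mul, smul_zero, neg_mul, mul_neg, smul_neg]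
    match_scalars <;> (try field_simp) <;> ring)) q⁻¹ • (bE * RF' + LE * bF + LE * c2 - c3 * RF')
  refine h.isUnit_comul.mul_left_cancel ?_
  rw [hD, ← map_mul, ha]
  have : serΔ q (euler (x 0 0)) = euler (serΔ q (x 0 0)) := (euler_mapAlgHom _ _).symm
  rw [this, hΔ, map_sub, euler_mul _ e, hM]
  linear_combination (norm := noncomm_ring) La * Ra * hbr - La * Ra * het

/-- The coproduct of the coefficients of the logarithm of `K_1(z)`. -/
theorem comul_coeff_psLog {n : ℕ} (hn : n ≠ 0) :
    QAffGL.comul q (coeff n (psLog (C (↑u⁻¹ : U q) * x 0 0))) =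
      1 ᵍ⊗ₜ[ℂ] coeff n (psLog (C (↑u⁻¹ : U q) * x 0 0)) +
        coeff n (psLog (C (↑u⁻¹ : U q) * x 0 0)) ᵍ⊗ₜ[ℂ] 1 -
      (ε * (l ^ n - 1) / (n * (q - q⁻¹))) • ∑ p ∈ Finset.HasAntidiagonal.antidiagonal n,
        coeff p.1 (gaussE x u) ᵍ⊗ₜ[ℂ] coeff p.2 (gaussF x u) := by
  have hn' : (n : ℂ) ≠ 0 := by exact_mod_cast hn
  have key := congrArg (coeff n) h.euler_serΔ_psLog
  have hs : coeff n (serL q (dil l (gaussE x u)) * serR q (dil l (gaussF x u))) =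
      l ^ n • ∑ p ∈ Finset.HasAntidiagonal.antidiagonal n,
        coeff p.1 (gaussE x u) ᵍ⊗ₜ[ℂ] coeff p.2 (gaussF x u) := by
    rw [serL, serR, mapAlgHom_dil, mapAlgHom_dil, ← map_mul, coeff_dil, ← serL, ← serR, ← tens_eq,
      tens, coeff_mk]
  rw [map_sub, map_add, PowerSeries.coeff_smul, map_sub, hs, ← tens_eq, tens, coeff_mk, coeff_euler,
    coeff_serΔ, coeff_serL, coeff_serR, coeff_euler, map_smul, map_smul] at key
  have h1 : ∀ y : U q, inclL q y = y ᵍ⊗ₜ[ℂ] 1 := fun _ => rfl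
  have h2 : ∀ y : U q, inclR q y = 1 ᵍ⊗ₜ[ℂ] y := fun _ => rfl
  rw [h1, h2] at key
  refine smul_right_injective _ hn' ?_
  change (n : ℂ) • _ = (n : ℂ) • _
  rw [key]
  match_scalars <;> field_simp

end RTTCoproduct

end coproductOfGauss

/-! ### The Drinfeld generators -/

section drinfeldCoproduct

variable {q : ℂ}

theorem hasParity_mk {x : ℕ → U q} (i j : Fin 2)
    (hx : ∀ n, parityAut q (x n) = gsgn i j • x n) : HasParity ((i : ℕ) + j) (mk x) := by
  ext n
  rw [mapAlgHom_apply, coeff_map, PowerSeries.coeff_smul, coeff_mk]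
  exact hx n

theorem serΔ_mk {x : Fin 2 → Fin 2 → ℕ → U q}
    (hx : ∀ i j n, comul q (x i j n) =
      ∑ k, sgn i k k j • ∑ p ∈ Finset.HasAntidiagonal.antidiagonal n, x i k p.1 ᵍ⊗ₜ[ℂ] x k j p.2)
    (i j : Fin 2) :
    serΔ q (mk (x i j)) = ∑ k, sgn i k k j • (serL q (mk (x i k)) * serR q (mk (x k j))) := by
  ext n
  simp only [map_sum, PowerSeries.coeff_smul, ← tens_eq, tens, coeff_serΔ, coeff_mk, hx]

theorem rttCoproduct_Smat (hq : q ≠ 0) (hq2 : q ^ 2 - 1 ≠ 0) (hq4 : q ^ 4 - 1 ≠ 0) :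
    RTTCoproduct q 1 (q ^ 2) (Smat q) (unitS q 0) where
  q_ne := hq
  q_sq := hq2
  q_four := hq4
  l_ne := pow_ne_zero 2 hq
  eps_ne := one_ne_zero
  const := constCoeff_mk _
  commute_const := by
    ext n
    rw [coeff_mul_C, coeff_C_mul]
    -- in the coefficient of `z^(n+1) w^0` only the part `z R'` contributes
    have := (U.sat q).ss (n + 1) 0 0 0 0 0
    simpa [rttL, rttR, Fin.sum_univ_two, upModes, Rz, Rw, sgn, qd, hq, Smat, unitS] using this
  one := diagonalRTT_up (s q) (U.sat q).ss 1
  line := diagonalRTT_up (s q) (U.sat q).ss (q ^ 2)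
  parity i j := hasParity_mk i j (parityAut_s q i j)
  comul i j := serΔ_mk (comul_s q) i j

theorem rttCoproduct_Tmat (hq : q ≠ 0) (hq2 : q ^ 2 - 1 ≠ 0) (hq4 : q ^ 4 - 1 ≠ 0) :
    RTTCoproduct q (-1) (q ^ 2)⁻¹ (Tmat q) (unitS q 0)⁻¹ where
  q_ne := hq
  q_sq := hq2
  q_four := hq4
  l_ne := inv_ne_zero (pow_ne_zero 2 hq)
  eps_ne := neg_ne_zero.2 one_ne_zero
  const := constCoeff_mk _
  commute_const := by
    ext n
    rw [coeff_mul_C, coeff_C_mul]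
    -- `w` occurs in `T(w)` with exponents at most `0`, so only the part `w R''` contributes
    have := (U.sat q).tt (-n) 1 0 0 0 0
    simpa [rttL, rttR, Fin.sum_univ_two, downModes, Rz, Rw, sgn, qd, hq, Tmat, unitS] using this
  one := by
    have := diagonalRTT_down (t q) (U.sat q).tt one_ne_zero
    rwa [inv_one] at this
  line := by
    have := diagonalRTT_down (t q) (U.sat q).tt (inv_ne_zero (pow_ne_zero 2 hq))
    rwa [inv_inv] at this
  parity i j := hasParity_mk i j (parityAut_t q i j)
  comul i j := serΔ_mk (comul_t q) i j

theorem constantCoeff_phiPlus (q : ℂ) : constantCoeff (phiPlus q) = phiZero q := by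
  have h0 : s q 1 0 0 = 0 := (U.sat q).s21
  simp [phiPlus, K₂plus, gaussK₂, Smat, phiZero, unitS, h0]

theorem constantCoeff_phiMinus (q : ℂ) :
    constantCoeff (phiMinus q) = (((phiZero q)⁻¹ : (U q)ˣ) : U q) := by
  have h0 : t q 0 1 0 = 0 := (U.sat q).t12
  have hc : Commute (unitS q 0) (unitS q 1) := Units.ext (unitS_comm q)
  have : (phiZero q)⁻¹ = unitS q 0 * (unitS q 1)⁻¹ := by
    rw [phiZero, mul_inv_rev, inv_inv]
    exact (hc.inv_right).eq.symm
  rw [this]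
  simp [phiMinus, K₂minus, gaussK₂, Tmat, unitS, h0]

theorem tmul_smul_add_smul (d : ℂ) (y : U q) :
    d • (1 ᵍ⊗ₜ[ℂ] y + y ᵍ⊗ₜ[ℂ] 1 : U2 q) = 1 ᵍ⊗ₜ[ℂ] (d • y) + (d • y) ᵍ⊗ₜ[ℂ] 1 := by
  have h1 := map_smul (inclL q) d y
  have h2 := map_smul (inclR q) d y
  rw [smul_add]
  exact congrArg₂ (· + ·) h2.symm h1.symm

/-- If `f` is even and grouplike, the coefficients of its normalized logarithm are primitive. -/
theorem comul_coeff_psLog_of_grouplike {f : (U q)⟦X⟧} {u : (U q)ˣ} (hu : constantCoeff f = u)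
    (hf : HasParity 0 f) (hΔ : serΔ q f = serL q f * serR q f) (n : ℕ) :
    comul q (coeff n (psLog (C (↑u⁻¹ : U q) * f))) =
      1 ᵍ⊗ₜ[ℂ] coeff n (psLog (C (↑u⁻¹ : U q) * f)) +
        coeff n (psLog (C (↑u⁻¹ : U q) * f)) ᵍ⊗ₜ[ℂ] 1 := by
  have := congrArg (coeff n) (serΔ_psLog_of_grouplike hu hf hΔ)
  rwa [map_add, coeff_serΔ, coeff_serL, coeff_serR] at this

theorem comul_c (hq : q ≠ 0) (hq2 : q ^ 2 - 1 ≠ 0) (hq4 : q ^ 4 - 1 ≠ 0) (r : ℤ) :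
    comul q (c q r) = 1 ᵍ⊗ₜ[ℂ] c q r + c q r ᵍ⊗ₜ[ℂ] 1 := by
  have hS := rttCoproduct_Smat hq hq2 hq4
  have hT := rttCoproduct_Tmat hq hq2 hq4
  rw [c]
  split_ifs
  · rw [map_smul, comul_coeff_psLog_of_grouplike (constantCoeff_phiPlus q) hS.parity_gaussPhi
      hS.serΔ_gaussPhi, tmul_smul_add_smul]
  · have := comul_coeff_psLog_of_grouplike (constantCoeff_phiMinus q) hT.parity_gaussPhi
      hT.serΔ_gaussPhi (-r).toNat
    rw [inv_inv] at this
    rw [map_smul, this, tmul_smul_add_smul]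

theorem sum_Eplus_tmul_Fplus (q : ℂ) (n : ℕ) :
    ∑ p ∈ Finset.HasAntidiagonal.antidiagonal n, coeff p.1 (Eplus q) ᵍ⊗ₜ[ℂ] coeff p.2 (Fplus q) =
      -∑ i ∈ Finset.range n, (E q i ᵍ⊗ₜ[ℂ] F q ((n : ℤ) - i) : U2 q) := by
  rw [Finset.Nat.sum_antidiagonal_eq_sum_range_succ
    (fun i j => (coeff i (Eplus q) ᵍ⊗ₜ[ℂ] coeff j (Fplus q) : U2 q)), Finset.sum_range_succ,
    Eplus_eq, Fplus_eq, ← Finset.sum_neg_distrib]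
  simp only [← inclL_mul_inclR, coeff_mk, map_neg, Nat.sub_self, if_true, neg_zero, map_zero,
    mul_zero, add_zero, mul_neg]
  refine Finset.sum_congr rfl fun i hi => ?_
  have hi := Finset.mem_range.1 hi
  rw [if_neg (by omega), Nat.cast_sub hi.le]

theorem sum_Eminus_tmul_Fminus (q : ℂ) (n : ℕ) :
    ∑ p ∈ Finset.HasAntidiagonal.antidiagonal n, coeff p.1 (Eminus q) ᵍ⊗ₜ[ℂ] coeff p.2 (Fminus q) =
      -∑ i ∈ Finset.range n, (E q (-(n : ℤ) + i) ᵍ⊗ₜ[ℂ] F q (-(i : ℤ)) : U2 q) := by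
  rw [← Finset.Nat.sum_antidiagonal_swap, Finset.Nat.sum_antidiagonal_eq_sum_range_succ_mk,
    Finset.sum_range_succ, Eminus_eq, Fminus_eq, ← Finset.sum_neg_distrib]
  simp only [← inclL_mul_inclR, Prod.fst_swap, Prod.snd_swap, coeff_mk, map_neg, Nat.sub_self,
    if_true, map_zero, zero_mul, neg_zero, add_zero, neg_mul]
  refine Finset.sum_congr rfl fun i hi => ?_
  have hi := Finset.mem_range.1 hi
  rw [if_neg (by omega), Nat.cast_sub hi.le, neg_sub, neg_add_eq_sub]

theorem comul_h_pos (hq : q ≠ 0) (hq2 : q ^ 2 - 1 ≠ 0) (hq4 : q ^ 4 - 1 ≠ 0) {r : ℕ} (hr : 0 < r) :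
    comul q (h q r) = 1 ᵍ⊗ₜ[ℂ] h q r + h q r ᵍ⊗ₜ[ℂ] 1 +
      (q ^ (r : ℤ) * qInt q r / (r * (q - q⁻¹))) •
        ∑ i ∈ Finset.range r, E q i ᵍ⊗ₜ[ℂ] F q ((r : ℤ) - i) := by
  have hr' : (r : ℂ) ≠ 0 := by exact_mod_cast hr.ne'
  have hk : q - q⁻¹ ≠ 0 := fun hk => hq2 (by field_simp at hk; simpa using hk)
  have key : comul q (coeff r (psLog (C (↑(unitS q 0)⁻¹ : U q) * K₁plus q))) = _ :=
    (rttCoproduct_Smat hq hq2 hq4).comul_coeff_psLog hr.ne'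
  rw [show gaussE _ _ = Eplus q from rfl, show gaussF _ _ = Fplus q from rfl,
    sum_Eplus_tmul_Fplus] at key
  rw [h, if_pos (by exact_mod_cast hr), Int.toNat_natCast, map_smul, key, smul_sub,
    ← tmul_smul_add_smul, smul_neg, smul_neg, sub_neg_eq_add, smul_smul]
  congr 2
  rw [qInt, zpow_neg, zpow_natCast]
  field_simp
  ring

theorem comul_h_neg (hq : q ≠ 0) (hq2 : q ^ 2 - 1 ≠ 0) (hq4 : q ^ 4 - 1 ≠ 0) {r : ℕ} (hr : 0 < r) :
    comul q (h q (-r)) = 1 ᵍ⊗ₜ[ℂ] h q (-r) + h q (-r) ᵍ⊗ₜ[ℂ] 1 +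
      (q ^ (-(r : ℤ)) * qInt q r / (r * (q⁻¹ - q))) •
        ∑ i ∈ Finset.range r, E q (-(r : ℤ) + i) ᵍ⊗ₜ[ℂ] F q (-(i : ℤ)) := by
  have hr' : (r : ℂ) ≠ 0 := by exact_mod_cast hr.ne'
  have hk : q - q⁻¹ ≠ 0 := fun hk => hq2 (by field_simp at hk; simpa using hk)
  have key : comul q (coeff r (psLog (C (↑((unitS q 0)⁻¹)⁻¹ : U q) * K₁minus q))) = _ :=
    (rttCoproduct_Tmat hq hq2 hq4).comul_coeff_psLog hr.ne'
  rw [show gaussE _ _ = Eminus q from rfl, show gaussF _ _ = Fminus q from rfl,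
    sum_Eminus_tmul_Fminus] at key
  rw [inv_inv] at key
  rw [h, if_neg (by omega), neg_neg, Int.toNat_natCast, map_smul, key, smul_sub,
    ← tmul_smul_add_smul, smul_neg, smul_neg, sub_neg_eq_add, smul_smul]
  congr 2
  have hk' : q⁻¹ - q ≠ 0 := fun hk' => hk (by rw [← neg_sub, hk', neg_zero])
  rw [qInt, zpow_neg, zpow_natCast, ← neg_sub q, inv_pow, ← pow_mul, mul_comm 2 r, pow_mul]
  field_simp
  ring

end drinfeldCoproduct

end

end QAffGL

theorem mainTheorem3 (q : ℂ) (hq : q ≠ 0) (hroot : ∀ n : ℕ, 0 < n → q ^ n ≠ 1) :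
    -- coproduct of `E^±(z)` and `F^±(z)`
    (QAffGL.comulSer q (QAffGL.Eplus q) =
      QAffGL.tens q 1 (QAffGL.Eplus q) + QAffGL.tens q (QAffGL.Eplus q) (QAffGL.phiPlus q)) ∧
    (QAffGL.comulSer q (QAffGL.Eminus q) =
      QAffGL.tens q 1 (QAffGL.Eminus q) + QAffGL.tens q (QAffGL.Eminus q) (QAffGL.phiMinus q)) ∧
    (QAffGL.comulSer q (QAffGL.Fplus q) =
      QAffGL.tens q (QAffGL.phiPlus q) (QAffGL.Fplus q) + QAffGL.tens q (QAffGL.Fplus q) 1) ∧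
    (QAffGL.comulSer q (QAffGL.Fminus q) =
      QAffGL.tens q (QAffGL.phiMinus q) (QAffGL.Fminus q) + QAffGL.tens q (QAffGL.Fminus q) 1) ∧
    -- `φ^±(z)` is grouplike and `C_r` is primitive
    (QAffGL.comulSer q (QAffGL.phiPlus q) =
      QAffGL.tens q (QAffGL.phiPlus q) (QAffGL.phiPlus q)) ∧
    (QAffGL.comulSer q (QAffGL.phiMinus q) =
      QAffGL.tens q (QAffGL.phiMinus q) (QAffGL.phiMinus q)) ∧
    (∀ r : ℤ, r ≠ 0 → QAffGL.comul q (QAffGL.c q r) =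
      1 ᵍ⊗ₜ[ℂ] QAffGL.c q r + QAffGL.c q r ᵍ⊗ₜ[ℂ] 1) ∧
    -- coproduct of `h_r` and `h_{-r}`
    (∀ r : ℕ, 0 < r → QAffGL.comul q (QAffGL.h q r) =
      1 ᵍ⊗ₜ[ℂ] QAffGL.h q r + QAffGL.h q r ᵍ⊗ₜ[ℂ] 1 +
        (q ^ (r : ℤ) * QAffGL.qInt q r / (r * (q - q⁻¹))) •
          ∑ i ∈ Finset.range r, QAffGL.E q i ᵍ⊗ₜ[ℂ] QAffGL.F q ((r : ℤ) - i)) ∧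
    (∀ r : ℕ, 0 < r → QAffGL.comul q (QAffGL.h q (-r)) =
      1 ᵍ⊗ₜ[ℂ] QAffGL.h q (-r) + QAffGL.h q (-r) ᵍ⊗ₜ[ℂ] 1 +
        (q ^ (-(r : ℤ)) * QAffGL.qInt q r / (r * (q⁻¹ - q))) •
          ∑ i ∈ Finset.range r, QAffGL.E q (-(r : ℤ) + i) ᵍ⊗ₜ[ℂ] QAffGL.F q (-(i : ℤ))) := by
  have hq2 : q ^ 2 - 1 ≠ 0 := sub_ne_zero.2 (hroot 2 two_pos)
  have hq4 : q ^ 4 - 1 ≠ 0 := sub_ne_zero.2 (hroot 4 four_pos)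
  have hS := QAffGL.rttCoproduct_Smat hq hq2 hq4
  have hT := QAffGL.rttCoproduct_Tmat hq hq2 hq4
  simp only [QAffGL.comulSer_eq, QAffGL.tens_eq, map_one, one_mul, mul_one]
  exact ⟨hS.serΔ_gaussE, hT.serΔ_gaussE, hS.serΔ_gaussF, hT.serΔ_gaussF, hS.serΔ_gaussPhi,
    hT.serΔ_gaussPhi, fun r _ => QAffGL.comul_c hq hq2 hq4 r,
    fun r hr => QAffGL.comul_h_pos hq hq2 hq4 hr, fun r hr => QAffGL.comul_h_neg hq hq2 hq4 hr⟩
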